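/- Let $H$ be a semisimple Hopf algebra over $\mathbb{C}$, with comultiplication $\Delta$ and counit $\epsilon$ (Sweedler notation $\Delta(h)=h_1\otimes h_2$). For a left $H$-module $M$ put $\mathcal{S}_M=\{h\in H : hm=\epsilon(h)m \text{ for all } m\in M\}$. Regard the irreducible characters of the dual algebra $H^*$ as elements of $H=H^{**}$. The kernel $H_M$ of the representation $M$ is the Hopf subalgebra of $H$ generated by those $d\in\mathrm{Irr}(H^*)$ with $dm=\epsilon(d)m$ for all $m\in M$. The Hopf kernel of a Hopf algebra map $f:H\to B$ is $$\mathrm{HKer}(f)=\{h\in H : h_1\otimes f(h_2)\otimes h_3=h_1\otimes f(1)\otimes h_2\}.$$ Proposition 2.8. Let $I$ be a Hopf ideal of $H$, let $\pi:H\to H/I$ be the canonical projection, and regard $H/I$ as a left $H$-module via $\pi$. Then $$\mathcal{S}_{H/I}=\{h\in H : \pi(h)=\epsilon(h)1\}\qquad\text{and}\qquad \mathrm{HKer}(\pi)=H_{H/I}.$$ In particular, $\mathrm{HKer}(\pi)=H_M$ for some finite-dimensional $H$-module $M$. -/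

import Mathlib

open scoped TensorProduct

universe u v w

namespace HopfKer

section General

variable {A : Type u} [Ring A] [HopfAlgebra ℂ A]

/-- A subalgebra `K` of a complex Hopf algebra is a Hopf subalgebra if `Δ(K) ⊆ K ⊗ K`
and `S(K) ⊆ K`. -/
structure IsHopfSubalgebra (K : Subalgebra ℂ A) : Prop where
  comul_mem : ∀ x ∈ K, Coalgebra.comul (R := ℂ) x ∈
    LinearMap.range (TensorProduct.mapIncl (Subalgebra.toSubmodule K) (Subalgebra.toSubmodule K))
  antipode_mem : ∀ x ∈ K, HopfAlgebra.antipode ℂ x ∈ K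

/-- Over a field, a tensor lying in `K ⊗ K` for all `K` in a family of subspaces lies in `L ⊗ L`,
where `L` is the intersection of the family. -/
lemma mem_range_mapIncl_sInf {V : Type u} [AddCommGroup V] [Module ℂ V]
    (F : Set (Submodule ℂ V)) (t : V ⊗[ℂ] V)
    (ht : ∀ K ∈ F, t ∈ LinearMap.range (TensorProduct.mapIncl K K)) :
    t ∈ LinearMap.range (TensorProduct.mapIncl (sInf F) (sInf F)) := by
  classical
  obtain ⟨p, hp⟩ := (sInf F).subtype.exists_leftInverse_of_injective (Submodule.ker_subtype _)
  have hp' : ∀ x ∈ sInf F, ((sInf F).subtype ∘ₗ p) x = x := fun x hx =>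
    congrArg Subtype.val (LinearMap.congr_fun hp ⟨x, hx⟩)
  let b := Module.Basis.ofVectorSpace ℂ V
  have h1 : (((sInf F).subtype ∘ₗ p).lTensor V) t = t := by
    have hmem : ∀ i, TensorProduct.equivFinsuppOfBasisLeft b t i ∈ sInf F := by
      intro i
      rw [Submodule.mem_sInf]
      intro K hK
      obtain ⟨s, hs⟩ := ht K hK
      rw [← hs]
      clear hs
      induction s with
      | zero => simp
      | tmul x y =>
        simp only [TensorProduct.mapIncl, TensorProduct.map_tmul, Submodule.subtype_apply,
          TensorProduct.equivFinsuppOfBasisLeft_apply_tmul_apply]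
        exact K.smul_mem _ y.2
      | add x y hx hy => simp only [map_add, Finsupp.add_apply]; exact K.add_mem hx hy
    conv_lhs => rw [← (TensorProduct.equivFinsuppOfBasisLeft b).symm_apply_apply t]
    conv_rhs => rw [← (TensorProduct.equivFinsuppOfBasisLeft b).symm_apply_apply t]
    rw [TensorProduct.equivFinsuppOfBasisLeft_symm_apply, Finsupp.sum, map_sum]
    refine Finset.sum_congr rfl fun i _ => ?_
    rw [LinearMap.lTensor_tmul, hp' _ (hmem i)]
  have h2 : (((sInf F).subtype ∘ₗ p).rTensor V) t = t := by
    have hmem : ∀ i, TensorProduct.equivFinsuppOfBasisRight b t i ∈ sInf F := by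
      intro i
      rw [Submodule.mem_sInf]
      intro K hK
      obtain ⟨s, hs⟩ := ht K hK
      rw [← hs]
      clear hs
      induction s with
      | zero => simp
      | tmul x y =>
        simp only [TensorProduct.mapIncl, TensorProduct.map_tmul, Submodule.subtype_apply,
          TensorProduct.equivFinsuppOfBasisRight_apply_tmul_apply]
        exact K.smul_mem _ x.2
      | add x y hx hy => simp only [map_add, Finsupp.add_apply]; exact K.add_mem hx hy
    conv_lhs => rw [← (TensorProduct.equivFinsuppOfBasisRight b).symm_apply_apply t]
    conv_rhs => rw [← (TensorProduct.equivFinsuppOfBasisRight b).symm_apply_apply t]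
    rw [TensorProduct.equivFinsuppOfBasisRight_symm_apply, Finsupp.sum, map_sum]
    refine Finset.sum_congr rfl fun i _ => ?_
    rw [LinearMap.rTensor_tmul, hp' _ (hmem i)]
  refine ⟨TensorProduct.map p p t, ?_⟩
  rw [TensorProduct.mapIncl, ← LinearMap.comp_apply, ← TensorProduct.map_comp,
    ← LinearMap.lTensor_comp_rTensor, LinearMap.comp_apply, h2, h1]

/-- An intersection of Hopf subalgebras is a Hopf subalgebra. -/
lemma IsHopfSubalgebra.sInf {F : Set (Subalgebra ℂ A)} (hF : ∀ K ∈ F, IsHopfSubalgebra K) :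
    IsHopfSubalgebra (sInf F) := by
  refine ⟨fun x hx => ?_, fun x hx => ?_⟩
  · rw [Algebra.sInf_toSubmodule]
    apply mem_range_mapIncl_sInf
    rintro _ ⟨K, hK, rfl⟩
    exact (hF K hK).comul_mem x (Algebra.mem_sInf.mp hx K hK)
  · rw [Algebra.mem_sInf]
    exact fun K hK => (hF K hK).antipode_mem x (Algebra.mem_sInf.mp hx K hK)

/-- The Hopf kernel `{a | a₁ ⊗ f(a₂) ⊗ a₃ = a₁ ⊗ f(1) ⊗ a₂}` of a Hopf algebra map `f : A → B`
(recall `f(1) = 1`), as the subalgebra on which two algebra maps `A → A ⊗ (B ⊗ A)` agree. -/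
noncomputable def hopfKernel {B : Type v} [Ring B] [HopfAlgebra ℂ B] (f : A →ₐc[ℂ] B) :
    Subalgebra ℂ A :=
  AlgHom.equalizer
    ((Algebra.TensorProduct.map (AlgHom.id ℂ A)
        ((Algebra.TensorProduct.map (f : A →ₐ[ℂ] B) (AlgHom.id ℂ A)).comp
          (Bialgebra.comulAlgHom ℂ A))).comp (Bialgebra.comulAlgHom ℂ A))
    ((Algebra.TensorProduct.map (AlgHom.id ℂ A)
        (Algebra.TensorProduct.includeRight : A →ₐ[ℂ] B ⊗[ℂ] A)).comp
      (Bialgebra.comulAlgHom ℂ A))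

variable (A) in
/-- The dual algebra `A^*`: linear functionals with the convolution product
`(f * g)(a) = f(a₁) g(a₂)` and unit `ε`. -/
abbrev DualAlg : Type u := WithConv (A →ₗ[ℂ] ℂ)

variable (A) in
/-- `Irr(A^*)`: the irreducible characters of the dual algebra `A^*`, as elements of `A` (that is,
of `A^{**}`). An element `d` is the character of the finite-dimensional simple `A^*`-module `V` if
`f(d)` is the trace of `f` on `V` for every `f` in `A^*`. -/
def irrDualCharacters : Set A :=
  {d | ∃ (V : Type u) (_ : AddCommGroup V) (_ : Module ℂ V) (_ : Module (DualAlg A) V)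
      (_ : IsScalarTower ℂ (DualAlg A) V),
      FiniteDimensional ℂ V ∧ IsSimpleModule (DualAlg A) V ∧
      ∀ f : DualAlg A, f.ofConv d = LinearMap.trace ℂ V (Algebra.lsmul ℂ ℂ V f)}

variable (A) (M : Type w) [AddCommGroup M] [Module ℂ M] [Module A M]

/-- The subalgebra `S_M` of the elements of `A` that act on the `A`-module `M` through the
counit. -/
def counitActing [IsScalarTower ℂ A M] : Subalgebra ℂ A where
  carrier := {h | ∀ m : M, h • m = Coalgebra.counit (R := ℂ) h • m}
  mul_mem' := by
    intro a b ha hb m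
    have : SMulCommClass A ℂ M := IsScalarTower.to_smulCommClass'
    rw [mul_smul, hb, smul_comm, ha, Bialgebra.counit_mul, smul_smul, mul_comm]
  add_mem' := by
    intro a b ha hb m
    rw [add_smul, ha, hb, map_add, add_smul]
  algebraMap_mem' := by
    intro r m
    rw [Bialgebra.counit_algebraMap, algebraMap_smul]

/-- `ker_A(χ)` for the character `χ` of the `A`-module `M`: the irreducible characters `d` of
`A^*` that act on `M` as the scalar `ε(d)`. -/
def kerCharacters : Set A :=
  {d | d ∈ irrDualCharacters A ∧ ∀ m : M, d • m = Coalgebra.counit (R := ℂ) d • m}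

/-- The kernel `A_M` of the representation `M`: the Hopf subalgebra generated by `ker_A(χ)`, i.e.
the intersection of all Hopf subalgebras that contain `ker_A(χ)`. -/
def repKernel : Subalgebra ℂ A :=
  sInf {K : Subalgebra ℂ A | IsHopfSubalgebra K ∧ kerCharacters A M ⊆ K}

lemma isHopfSubalgebra_repKernel : IsHopfSubalgebra (repKernel A M) :=
  IsHopfSubalgebra.sInf fun _ hK => hK.1

end General

end HopfKer

/-!
The heart of the matter is that the dual `H^*` of a semisimple complex Hopf algebra `H` is again a
semisimple algebra (`isSemisimpleRing_dualAlg`).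

Semisimplicity of `H` yields a two-sided integral `Λ` with `ε(Λ) = 1`, and `Λ₁ ⊗ S(Λ₂)` is a
separability idempotent, so `H` has finite dimension. The maps `f ↦ f(Λ₁)Λ₂` and `f ↦ Λ₁f(Λ₂)` from
`H^*` to `H` are bijective; the preimages `l` and `ρ` of `1` are a right and a left integral of
`H^*`. They satisfy `l(S²(h)x) = l(xh)` and `ρ(xS²(h)) = ρ(hx)`, and `ρ = l(·g)` for a group-like
element `g`. As `l` is nondegenerate, comparing the two gives Radford's formula `S⁴(h) = ghg⁻¹`, and
since `g` has finite order, so has `S²`. Moreover `ρ(1)` is the trace of `S²`.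

Decompose `H` as a product of matrix algebras and write `ρ = ∑ tr(wᵢ ·)`. Then `S²` is conjugation
by `w`, and a power of `w` is central; by the unitary trick, `tr(wᵢ⁻¹)` is a positive multiple of the
complex conjugate of `tr(wᵢ)`. Hence `Tr(S²) = ∑ tr(wᵢ) tr(wᵢ⁻¹)` is a positive combination of the
`|tr(wᵢ)|²`. These do not all vanish, because `1 = ρ(Λ)` is a linear combination of the `tr(wᵢ)`, as
`Λ` is central. So `ρ(1) ≠ 0`, and Maschke's argument makes `H^*` semisimple.

Given this, let `π : H → B = H/I`. If `d` is the character of a simple `H^*`-module `V` and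
`π(d) = ε(d)1`, then a normalized integral of `B^*` acts on `V` as an idempotent whose trace is
`dim V`. It is the identity, so `B^*` acts on `V` through `b ↦ b(1)`, which says that `d` lies in the
Hopf kernel (`mem_hopfKernel_of_mem_irrDualCharacters`). As the Hopf kernel is a Hopf subalgebra, it
contains the kernel of the representation `H/I`. Conversely, as `H^*` is semisimple, a subcoalgebra
is contained in any subcoalgebra that contains its irreducible characters
(`le_of_irrDualCharacters_mem`), and each irreducible character `d` in the Hopf kernel satisfies
`π(d) = ε(d)1`.
-/

namespace HopfKer

open Coalgebra HopfAlgebra LinearMap WithConv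

/-! ### Separable algebras over a field -/

section Separable

variable {R : Type u} [Ring R] [Algebra ℂ R]

/-- If `e = ∑ xᵢ ⊗ yᵢ` is a separability idempotent with the `yᵢ` linearly independent, then the `xᵢ`
span a left ideal, and `a = ∑ (a xᵢ) yᵢ` is determined by the products `a xᵢ`. -/
lemma finiteDimensional_of_separable (e : R ⊗[ℂ] R)
    (he : ∀ r : R, (r ⊗ₜ[ℂ] (1 : R)) * e = e * ((1 : R) ⊗ₜ[ℂ] r))
    (h1 : mul' ℂ R e = 1) : FiniteDimensional ℂ R := by
  classical
  let b := Module.Basis.ofVectorSpace ℂ R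
  obtain ⟨x, rfl⟩ := (TensorProduct.equivFinsuppOfBasisRight (M := R) b).symm.surjective e
  simp only [TensorProduct.equivFinsuppOfBasisRight_symm_apply, Finsupp.sum] at he h1
  let X : Submodule ℂ R := Submodule.span ℂ (x.support.image x)
  have hX : ∀ (a : R) (j), a * x j ∈ X := by
    intro a j
    have h2 := congrArg (fun t => TensorProduct.equivFinsuppOfBasisRight b t j) (he a)
    simp only [Finset.mul_sum, Finset.sum_mul, Algebra.TensorProduct.tmul_mul_tmul, one_mul,
      mul_one, map_sum, Finsupp.finsetSum_apply,
      TensorProduct.equivFinsuppOfBasisRight_apply_tmul_apply, Module.Basis.repr_self,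
      Finsupp.single_apply, ite_smul, one_smul, zero_smul, Finset.sum_ite_eq'] at h2
    by_cases hj : j ∈ x.support
    · rw [if_pos hj] at h2
      rw [h2]
      exact X.sum_mem fun i hi => X.smul_mem _ <|
        Submodule.subset_span <| Finset.mem_coe.mpr <| Finset.mem_image_of_mem _ hi
    · rw [Finsupp.notMem_support_iff.mp hj, mul_zero]
      exact X.zero_mem
  let T : R →ₗ[ℂ] (x.support → X) := LinearMap.pi fun j =>
    (LinearMap.mulRight ℂ (x j)).codRestrict X fun a => hX a j
  have hT : Function.Injective T := by
    rw [← LinearMap.ker_eq_bot, LinearMap.ker_eq_bot']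
    intro a ha
    have h3 : ∀ j ∈ x.support, a * x j = 0 := fun j hj =>
      congrArg Subtype.val (congrFun ha ⟨j, hj⟩)
    calc a = a * ∑ j ∈ x.support, x j * b j := by
            rw [map_sum] at h1; simp only [mul'_apply] at h1; rw [h1, mul_one]
      _ = 0 := by
        rw [Finset.mul_sum]
        exact Finset.sum_eq_zero fun j hj => by rw [← mul_assoc, h3 j hj, zero_mul]
  have : FiniteDimensional ℂ X := FiniteDimensional.span_finset ℂ _
  exact Module.Finite.of_injective T hT

/-- Maschke's argument: averaging a linear projection over a separability idempotent makes it
`R`-linear. -/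
lemma isSemisimpleRing_of_separable (e : R ⊗[ℂ] R)
    (he : ∀ r : R, (r ⊗ₜ[ℂ] (1 : R)) * e = e * ((1 : R) ⊗ₜ[ℂ] r))
    (h1 : mul' ℂ R e = 1) : IsSemisimpleRing R := by
  refine { exists_isCompl := fun N => ?_ }
  obtain ⟨p₀, hp₀⟩ := (N.restrictScalars ℂ).subtype.exists_leftInverse_of_injective
    (Submodule.ker_subtype _)
  let p : R →ₗ[ℂ] R := (N.restrictScalars ℂ).subtype ∘ₗ p₀
  have hpN : ∀ x, p x ∈ N := fun x => (p₀ x).2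
  have hp : ∀ x ∈ N, p x = x := fun x hx =>
    congrArg Subtype.val (LinearMap.congr_fun hp₀ ⟨x, hx⟩)
  clear_value p
  -- The average of the linear projection `p` over `e = ∑ xᵢ ⊗ yᵢ` is `m ↦ ∑ xᵢ p(yᵢ m)`.
  let Q (m : R) : R ⊗[ℂ] R →ₗ[ℂ] R := mul' ℂ R ∘ₗ (p ∘ₗ mulRight ℂ m).lTensor R
  have hQ : ∀ m x y, Q m (x ⊗ₜ y) = x * p (y * m) := fun _ _ _ => rfl
  let q : R →ₗ[R] R :=
    { toFun := fun m => Q m e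
      map_add' := fun m n => by
        rw [← LinearMap.add_apply]
        congr 1
        ext x y
        simp [hQ, mul_add]
      map_smul' := fun r m => by
        have h2 : Q (r * m) = Q m ∘ₗ mulRight ℂ ((1 : R) ⊗ₜ[ℂ] r) := by
          ext x y
          simp [hQ, mul_assoc]
        have h3 : ∀ t, Q m ((r ⊗ₜ[ℂ] (1 : R)) * t) = r * Q m t := by
          intro t
          induction t with
          | zero => simp
          | tmul x y => simp [hQ, mul_assoc]
          | add x y hx hy => rw [mul_add, map_add, hx, hy, map_add, mul_add]
        rw [smul_eq_mul, h2, LinearMap.comp_apply, mulRight_apply, ← he, h3, RingHom.id_apply,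
          smul_eq_mul] }
  have hqN : ∀ m, q m ∈ N := by
    have h : ∀ m t, Q m t ∈ N := by
      intro m t
      induction t with
      | zero => rw [map_zero]; exact N.zero_mem
      | tmul x y => exact N.smul_mem x (hpN _)
      | add x y hx hy => rw [map_add]; exact N.add_mem hx hy
    exact fun m => h m e
  refine ⟨ker (q.codRestrict N hqN), LinearMap.isCompl_of_proj fun n => Subtype.ext ?_⟩
  have h4 : ∀ t, Q n t = mul' ℂ R t * n := by
    intro t
    induction t with
    | zero => simp
    | tmul x y => rw [hQ, mul'_apply, hp (y * n) (N.smul_mem y n.2), mul_assoc]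
    | add x y hx hy => rw [map_add, hx, hy, map_add, add_mul]
  change Q n e = n
  rw [h4, h1, one_mul]

end Separable

/-! ### Integrals in a semisimple Hopf algebra -/

/-- In a semisimple algebra, an augmentation has a left integral of augmentation `1`: a generator
of a left ideal complementary to the augmentation ideal. -/
lemma exists_left_integral {R : Type u} [Ring R] [Algebra ℂ R] [IsSemisimpleRing R]
    (ε : R →ₐ[ℂ] ℂ) : ∃ x : R, ε x = 1 ∧ ∀ a, a * x = ε a • x := by
  obtain ⟨L, hL⟩ := exists_isCompl (RingHom.ker ε : Ideal R)
  obtain ⟨k, hk, x, hx, hkx⟩ := Submodule.mem_sup.mp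
    (hL.sup_eq_top ▸ Submodule.mem_top : (1 : R) ∈ RingHom.ker ε ⊔ L)
  refine ⟨x, ?_, fun a => ?_⟩
  · have := congrArg ε hkx
    rwa [map_add, RingHom.mem_ker.mp hk, zero_add, map_one] at this
  · have h1 : a * x - ε a • x ∈ L :=
      L.sub_mem (L.mul_mem_left _ hx) (by rw [Algebra.smul_def]; exact L.mul_mem_left _ hx)
    have h2 : a * x - ε a • x ∈ (RingHom.ker ε : Ideal R) := by
      rw [RingHom.mem_ker, map_sub, map_mul, map_smul, smul_eq_mul, sub_self]
    exact sub_eq_zero.mp (Submodule.disjoint_def.mp hL.disjoint _ h2 h1)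

/-- A normalized two-sided integral `Λ`, i.e. `aΛ = Λa = ε(a)Λ` and `ε(Λ) = 1`. -/
structure IsNormalizedIntegral {A : Type u} [Ring A] [HopfAlgebra ℂ A] (Λ : A) : Prop where
  counit_eq : counit (R := ℂ) Λ = 1
  left : ∀ a, a * Λ = counit (R := ℂ) a • Λ
  right : ∀ a, Λ * a = counit (R := ℂ) a • Λ

variable {A : Type u} [Ring A] [HopfAlgebra ℂ A]

/-- A normalized left integral and a normalized right integral are equal. -/
lemma exists_isNormalizedIntegral [IsSemisimpleRing A] :
    ∃ Λ : A, IsNormalizedIntegral Λ := by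
  obtain ⟨x, hx1, hx⟩ := exists_left_integral (Bialgebra.counitAlgHom ℂ A)
  obtain ⟨y, hy1, hy⟩ := exists_left_integral (R := Aᵐᵒᵖ)
    ((Bialgebra.counitAlgHom ℂ A).fromOpposite fun _ _ => Commute.all _ _)
  obtain ⟨y, rfl⟩ := MulOpposite.op_surjective y
  have hy' : ∀ a, y * a = counit (R := ℂ) a • y := fun a =>
    MulOpposite.op_injective (by simpa using hy (MulOpposite.op a))
  simp only [Bialgebra.counitAlgHom_apply, AlgHom.fromOpposite_apply, MulOpposite.unop_op,
    Function.comp_apply] at hx hx1 hy1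
  have hxy : x = y := by
    rw [← one_smul ℂ x, ← hy1, ← hx y, hy' x, hx1, one_smul]
  exact ⟨x, hx1, hx, hxy ▸ hy'⟩

/-! ### Convolution identities for the antipode -/

/-- The algebra map `a ↦ a ⊗ 1`, as a linear map. -/
abbrev inl (A : Type u) [Ring A] [HopfAlgebra ℂ A] : A →ₗ[ℂ] A ⊗[ℂ] A :=
  (Algebra.TensorProduct.includeLeft : A →ₐ[ℂ] A ⊗[ℂ] A).toLinearMap

/-- The algebra map `a ↦ 1 ⊗ a`, as a linear map. -/
abbrev inr (A : Type u) [Ring A] [HopfAlgebra ℂ A] : A →ₗ[ℂ] A ⊗[ℂ] A :=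
  (Algebra.TensorProduct.includeRight : A →ₐ[ℂ] A ⊗[ℂ] A).toLinearMap

lemma inl_conv_inr : toConv (inl A) * toConv (inr A) = toConv (comul (R := ℂ) (A := A)) := by
  ext a
  rw [(ℛ ℂ a).convMul_apply, ← (ℛ ℂ a).eq]
  simp

lemma algHom_conv_antipode {B : Type*} [Ring B] [Algebra ℂ B] (f : A →ₐ[ℂ] B) :
    toConv f.toLinearMap * toConv (f.toLinearMap ∘ₗ antipode ℂ) = 1 := by
  have := algHom_comp_convMul_distrib f (toConv (LinearMap.id (R := ℂ) (M := A)))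
    (toConv (antipode ℂ))
  rw [id_mul_antipode] at this
  rw [← toConv_ofConv (toConv f.toLinearMap * _)]
  erw [← this]
  ext a
  simp

lemma antipode_conv_algHom {B : Type*} [Ring B] [Algebra ℂ B] (f : A →ₐ[ℂ] B) :
    toConv (f.toLinearMap ∘ₗ antipode ℂ) * toConv f.toLinearMap = 1 := by
  have := algHom_comp_convMul_distrib f (toConv (antipode ℂ))
    (toConv (LinearMap.id (R := ℂ) (M := A)))
  rw [antipode_mul_id] at this
  rw [← toConv_ofConv (_ * toConv f.toLinearMap)]
  erw [← this]
  ext a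
  simp

/-- `Δ(a₁)(1 ⊗ S(a₂)) = a ⊗ 1`. -/
lemma comul_conv_inr_antipode :
    toConv (comul (R := ℂ) (A := A)) * toConv (inr A ∘ₗ antipode ℂ) = toConv (inl A) := by
  rw [← inl_conv_inr, mul_assoc, algHom_conv_antipode, mul_one]

/-- `(S(a₁) ⊗ 1)Δ(a₂) = 1 ⊗ a`. -/
lemma inl_antipode_conv_comul :
    toConv (inl A ∘ₗ antipode ℂ) * toConv (comul (R := ℂ) (A := A)) = toConv (inr A) := by
  rw [← inl_conv_inr, ← mul_assoc, antipode_conv_algHom, one_mul]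

/-- The antipode reverses the comultiplication: `Δ(S(a)) = S(a₂) ⊗ S(a₁)`. -/
lemma comul_comp_antipode :
    toConv (comul ∘ₗ antipode ℂ : A →ₗ[ℂ] A ⊗[ℂ] A) =
      toConv (inr A ∘ₗ antipode ℂ) * toConv (inl A ∘ₗ antipode ℂ) := by
  refine left_inv_eq_right_inv (a := toConv (comul (R := ℂ) (A := A)))
    (antipode_conv_algHom (Bialgebra.comulAlgHom ℂ A)) ?_
  rw [← mul_assoc, comul_conv_inr_antipode, algHom_conv_antipode]

section ConvMul

variable {B : Type*} [Ring B] [Algebra ℂ B]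

lemma mulLeft_comp_conv (x : B) (f g : WithConv (A →ₗ[ℂ] B)) :
    mulLeft ℂ x ∘ₗ (f * g).ofConv = (toConv (mulLeft ℂ x ∘ₗ f.ofConv) * g).ofConv := by
  ext a
  change x * (f * g) a = (toConv (mulLeft ℂ x ∘ₗ f.ofConv) * g) a
  simp_rw [(ℛ ℂ a).convMul_apply, Finset.mul_sum]
  simp [mul_assoc]

lemma mulRight_comp_conv (x : B) (f g : WithConv (A →ₗ[ℂ] B)) :
    mulRight ℂ x ∘ₗ (f * g).ofConv = (f * toConv (mulRight ℂ x ∘ₗ g.ofConv)).ofConv := by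
  ext a
  change (f * g) a * x = (f * toConv (mulRight ℂ x ∘ₗ g.ofConv)) a
  simp_rw [(ℛ ℂ a).convMul_apply, Finset.sum_mul]
  simp [mul_assoc]

end ConvMul

/-- `Δ(Λ)(a ⊗ 1) = Δ(Λ)(1 ⊗ S(a))` for a right integral `Λ`. -/
lemma IsNormalizedIntegral.comul_mul_inl {Λ : A} (hΛ : IsNormalizedIntegral Λ) (a : A) :
    comul (R := ℂ) Λ * inl A a = comul (R := ℂ) Λ * inr A (antipode ℂ a) := by
  have h1 := mulLeft_comp_conv (comul (R := ℂ) Λ) (toConv (comul (R := ℂ) (A := A)))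
    (toConv (inr A ∘ₗ antipode ℂ))
  have h2 := mulLeft_comp_conv (comul (R := ℂ) Λ) (1 : WithConv (A →ₗ[ℂ] A ⊗[ℂ] A))
    (toConv (inr A ∘ₗ antipode ℂ))
  have h3 : mulLeft ℂ (comul (R := ℂ) Λ) ∘ₗ comul (R := ℂ) (A := A) =
      mulLeft ℂ (comul (R := ℂ) Λ) ∘ₗ (1 : WithConv (A →ₗ[ℂ] A ⊗[ℂ] A)).ofConv := by
    ext x
    change comul (R := ℂ) Λ * comul x = comul (R := ℂ) Λ * algebraMap ℂ _ (counit x)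
    rw [← Bialgebra.comul_mul, hΛ.right, map_smul, Algebra.algebraMap_eq_smul_one, mul_smul_comm,
      mul_one]
  rw [comul_conv_inr_antipode] at h1
  simp only at h1 h2
  rw [h3, ← h2, one_mul] at h1
  exact LinearMap.congr_fun h1 a

/-- `(1 ⊗ a)Δ(Λ) = (S(a) ⊗ 1)Δ(Λ)` for a left integral `Λ`. -/
lemma IsNormalizedIntegral.inr_mul_comul {Λ : A} (hΛ : IsNormalizedIntegral Λ) (a : A) :
    inr A a * comul (R := ℂ) Λ = inl A (antipode ℂ a) * comul (R := ℂ) Λ := by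
  have h1 := mulRight_comp_conv (comul (R := ℂ) Λ) (toConv (inl A ∘ₗ antipode ℂ))
    (toConv (comul (R := ℂ) (A := A)))
  have h2 := mulRight_comp_conv (comul (R := ℂ) Λ) (toConv (inl A ∘ₗ antipode ℂ))
    (1 : WithConv (A →ₗ[ℂ] A ⊗[ℂ] A))
  have h3 : mulRight ℂ (comul (R := ℂ) Λ) ∘ₗ comul (R := ℂ) (A := A) =
      mulRight ℂ (comul (R := ℂ) Λ) ∘ₗ (1 : WithConv (A →ₗ[ℂ] A ⊗[ℂ] A)).ofConv := by
    ext x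
    change comul x * comul (R := ℂ) Λ = algebraMap ℂ _ (counit x) * comul (R := ℂ) Λ
    rw [← Bialgebra.comul_mul, hΛ.left, map_smul, Algebra.algebraMap_eq_smul_one, smul_mul_assoc,
      one_mul]
  rw [inl_antipode_conv_comul] at h1
  simp only at h1 h2
  rw [h3, ← h2, mul_one] at h1
  exact LinearMap.congr_fun h1 a

/-- `(id ⊗ S)(Δ(a₁)t)(1 ⊗ a₂) = (a ⊗ 1)(id ⊗ S)(t)`. -/
lemma lTensor_antipode_comul_mul_conv_inr (t : A ⊗[ℂ] A) :
    toConv ((antipode ℂ).lTensor A ∘ₗ mulRight ℂ t ∘ₗ comul (R := ℂ) (A := A)) *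
        toConv (inr A) =
      toConv (mulRight ℂ ((antipode ℂ).lTensor A t) ∘ₗ inl A) := by
  induction t with
  | zero => simp
  | add x y hx hy =>
    have hadd : ∀ z w : A ⊗[ℂ] A, mulRight ℂ (z + w) = mulRight ℂ z + mulRight ℂ w :=
      fun z w => by ext; simp [mul_add]
    simp only [map_add, hadd, LinearMap.add_comp, LinearMap.comp_add, toConv_add, add_mul, hx, hy]
  | tmul x y =>
    have h1 : toConv ((antipode ℂ).lTensor A ∘ₗ mulRight ℂ (x ⊗ₜ[ℂ] y) ∘ₗ
        comul (R := ℂ) (A := A)) = toConv (mulRight ℂ (x ⊗ₜ[ℂ] antipode ℂ y) ∘ₗ inl A) *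
          toConv (inr A ∘ₗ antipode ℂ) := by
      ext a
      rw [(ℛ ℂ a).convMul_apply]
      change (antipode ℂ).lTensor A (comul (R := ℂ) a * (x ⊗ₜ[ℂ] y)) = _
      rw [← (ℛ ℂ a).eq, Finset.sum_mul, map_sum]
      simp [antipode_mul_antidistrib]
    rw [h1, mul_assoc, antipode_conv_algHom, mul_one, lTensor_tmul]

/-- A semisimple Hopf algebra is finite-dimensional, as `Λ₁ ⊗ S(Λ₂)` is a separability
idempotent. -/
lemma IsNormalizedIntegral.finiteDimensional {Λ : A} (hΛ : IsNormalizedIntegral Λ) :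
    FiniteDimensional ℂ A := by
  refine finiteDimensional_of_separable ((antipode ℂ).lTensor A (comul (R := ℂ) Λ)) ?_ ?_
  · intro r
    have h1 : toConv ((antipode ℂ).lTensor A ∘ₗ mulRight ℂ (comul (R := ℂ) Λ) ∘ₗ
        comul (R := ℂ) (A := A)) * toConv (inr A) =
        toConv (mulLeft ℂ ((antipode ℂ).lTensor A (comul (R := ℂ) Λ)) ∘ₗ inr A) := by
      have h2 := mulLeft_comp_conv ((antipode ℂ).lTensor A (comul (R := ℂ) Λ))
        (1 : WithConv (A →ₗ[ℂ] A ⊗[ℂ] A)) (toConv (inr A))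
      rw [one_mul] at h2
      rw [show mulLeft ℂ ((antipode ℂ).lTensor A (comul (R := ℂ) Λ)) ∘ₗ inr A = _ from h2,
        toConv_ofConv]
      congr 2
      ext x
      change (antipode ℂ).lTensor A (comul x * comul (R := ℂ) Λ) = _ * algebraMap ℂ _ (counit x)
      rw [← Bialgebra.comul_mul, hΛ.left, map_smul, map_smul, Algebra.algebraMap_eq_smul_one,
        mul_smul_comm, mul_one]
    rw [lTensor_antipode_comul_mul_conv_inr] at h1
    exact LinearMap.congr_fun (toConv_injective h1) r
  · rw [mul_antipode_lTensor_comul_apply, hΛ.counit_eq, map_one]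

/-! ### The actions of the dual algebra -/

/-- The left action of the dual algebra: `f ⇀ a = a₁ f(a₂)`. -/
noncomputable def lhit (f : DualAlg A) : A →ₗ[ℂ] A :=
  TensorProduct.rid ℂ A ∘ₗ f.ofConv.lTensor A ∘ₗ comul

/-- The right action of the dual algebra: `a ↼ f = f(a₁) a₂`. -/
noncomputable def rhit (f : DualAlg A) : A →ₗ[ℂ] A :=
  TensorProduct.lid ℂ A ∘ₗ f.ofConv.rTensor A ∘ₗ comul

/-- The functional `x ↦ f(ax)`. -/
def ltrans (a : A) (f : DualAlg A) : DualAlg A := toConv (f.ofConv ∘ₗ mulLeft ℂ a)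

/-- The functional `x ↦ f(xa)`. -/
def rtrans (a : A) (f : DualAlg A) : DualAlg A := toConv (f.ofConv ∘ₗ mulRight ℂ a)

@[simp] lemma ltrans_apply (a : A) (f : DualAlg A) (x : A) : ltrans a f x = f (a * x) := rfl

@[simp] lemma rtrans_apply (a : A) (f : DualAlg A) (x : A) : rtrans a f x = f (x * a) := rfl

lemma dual_ext {x y : A} (h : ∀ f : DualAlg A, f x = f y) : x = y := by
  rw [← sub_eq_zero, ← Module.forall_dual_apply_eq_zero_iff ℂ]
  intro f
  rw [map_sub, sub_eq_zero]
  exact h (toConv f)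

/-- Tensors over a field are separated by contraction with functionals of the first factor. -/
lemma tensor_ext {V : Type v} {W : Type w} [AddCommGroup V] [Module ℂ V] [AddCommGroup W]
    [Module ℂ W] {s t : V ⊗[ℂ] W}
    (h : ∀ f : V →ₗ[ℂ] ℂ, TensorProduct.lid ℂ W (f.rTensor W s) =
      TensorProduct.lid ℂ W (f.rTensor W t)) : s = t := by
  classical
  let b := Module.Basis.ofVectorSpace ℂ V
  have key : ∀ (t : V ⊗[ℂ] W) i, TensorProduct.equivFinsuppOfBasisLeft b t i =
      TensorProduct.lid ℂ W ((b.coord i).rTensor W t) := by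
    intro t i
    induction t with
    | zero => simp
    | tmul x y => simp
    | add x y hx hy => simp only [map_add, Finsupp.add_apply, hx, hy]
  refine (TensorProduct.equivFinsuppOfBasisLeft b).injective (Finsupp.ext fun i => ?_)
  rw [key, key, h]

lemma mul_apply_eq_lhit (f g : DualAlg A) (a : A) : (f * g) a = f (lhit g a) := by
  rw [(ℛ ℂ a).convMul_apply]
  change _ = f (TensorProduct.rid ℂ A (g.ofConv.lTensor A (comul a)))
  conv_rhs => rw [← (ℛ ℂ a).eq]
  simp [mul_comm]

lemma mul_apply_eq_rhit (f g : DualAlg A) (a : A) : (f * g) a = g (rhit f a) := by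
  rw [(ℛ ℂ a).convMul_apply]
  change _ = g (TensorProduct.lid ℂ A (f.ofConv.rTensor A (comul a)))
  conv_rhs => rw [← (ℛ ℂ a).eq]
  simp

lemma lhit_mul (f g : DualAlg A) (a : A) : lhit (f * g) a = lhit f (lhit g a) :=
  dual_ext fun k => by
    rw [← mul_apply_eq_lhit, ← mul_assoc, mul_apply_eq_lhit, mul_apply_eq_lhit]

lemma rhit_mul (f g : DualAlg A) (a : A) : rhit (f * g) a = rhit g (rhit f a) :=
  dual_ext fun k => by
    rw [← mul_apply_eq_rhit, mul_assoc, mul_apply_eq_rhit, mul_apply_eq_rhit]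

lemma one_apply (a : A) : (1 : DualAlg A) a = counit (R := ℂ) a := rfl

lemma lhit_one (f : DualAlg A) : lhit f (1 : A) = f 1 • (1 : A) := by
  simp [lhit, Algebra.TensorProduct.one_def]

lemma rhit_one (f : DualAlg A) : rhit f (1 : A) = f 1 • (1 : A) := by
  simp [rhit, Algebra.TensorProduct.one_def]

/-! ### Frobenius structure of a semisimple Hopf algebra -/

section Slices

variable (f : A →ₗ[ℂ] ℂ) (a : A) (t : A ⊗[ℂ] A)

lemma lid_rTensor_inl_mul : TensorProduct.lid ℂ A (f.rTensor A (inl A a * t)) =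
    TensorProduct.lid ℂ A ((f ∘ₗ mulLeft ℂ a).rTensor A t) := by
  induction t with
  | zero => simp
  | tmul x y => simp
  | add x y hx hy => simp only [mul_add, map_add, hx, hy]

lemma lid_rTensor_inr_mul : TensorProduct.lid ℂ A (f.rTensor A (inr A a * t)) =
    a * TensorProduct.lid ℂ A (f.rTensor A t) := by
  induction t with
  | zero => simp
  | tmul x y => simp
  | add x y hx hy => simp only [mul_add, map_add, hx, hy]

lemma lid_rTensor_mul_inl : TensorProduct.lid ℂ A (f.rTensor A (t * inl A a)) =
    TensorProduct.lid ℂ A ((f ∘ₗ mulRight ℂ a).rTensor A t) := by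
  induction t with
  | zero => simp
  | tmul x y => simp
  | add x y hx hy => simp only [add_mul, map_add, hx, hy]

lemma lid_rTensor_mul_inr : TensorProduct.lid ℂ A (f.rTensor A (t * inr A a)) =
    TensorProduct.lid ℂ A (f.rTensor A t) * a := by
  induction t with
  | zero => simp
  | tmul x y => simp
  | add x y hx hy => simp only [add_mul, map_add, hx, hy]

lemma rid_lTensor_inl_mul : TensorProduct.rid ℂ A (f.lTensor A (inl A a * t)) =
    a * TensorProduct.rid ℂ A (f.lTensor A t) := by
  induction t with
  | zero => simp
  | tmul x y => simp
  | add x y hx hy => simp only [mul_add, map_add, hx, hy]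

lemma rid_lTensor_inr_mul : TensorProduct.rid ℂ A (f.lTensor A (inr A a * t)) =
    TensorProduct.rid ℂ A ((f ∘ₗ mulLeft ℂ a).lTensor A t) := by
  induction t with
  | zero => simp
  | tmul x y => simp
  | add x y hx hy => simp only [mul_add, map_add, hx, hy]

lemma rid_lTensor_mul_inl : TensorProduct.rid ℂ A (f.lTensor A (t * inl A a)) =
    TensorProduct.rid ℂ A (f.lTensor A t) * a := by
  induction t with
  | zero => simp
  | tmul x y => simp
  | add x y hx hy => simp only [add_mul, map_add, hx, hy]

lemma rid_lTensor_mul_inr : TensorProduct.rid ℂ A (f.lTensor A (t * inr A a)) =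
    TensorProduct.rid ℂ A ((f ∘ₗ mulRight ℂ a).lTensor A t) := by
  induction t with
  | zero => simp
  | tmul x y => simp
  | add x y hx hy => simp only [add_mul, map_add, hx, hy]

end Slices

/-- For `t = ∑ aᵢ ⊗ bᵢ`, the operator `h ↦ ∑ B(aᵢ, h) bᵢ` has trace `∑ B(aᵢ, bᵢ)`. -/
lemma trace_eq_of_apply_eq_lid [FiniteDimensional ℂ A] (t : A ⊗[ℂ] A) (B : A →ₗ[ℂ] A →ₗ[ℂ] ℂ)
    (T : A →ₗ[ℂ] A) (hT : ∀ h, T h = TensorProduct.lid ℂ A ((B.flip h).rTensor A t)) :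
    LinearMap.trace ℂ A T = TensorProduct.lift B t := by
  induction t generalizing T with
  | zero =>
    rw [show T = 0 by ext h; simp [hT], map_zero, map_zero]
  | tmul x y =>
    rw [show T = (B x).smulRight y by ext h; simp [hT], LinearMap.trace_smulRight]
    simp
  | add x y hx hy =>
    let P (z : A ⊗[ℂ] A) : A →ₗ[ℂ] A :=
      TensorProduct.lid ℂ A ∘ₗ (LinearMap.applyₗ z) ∘ₗ (LinearMap.rTensorHom A) ∘ₗ B.flip
    rw [show T = P x + P y by ext h; simp [hT, P], map_add, hx (P x) fun _ => rfl,
      hy (P y) fun _ => rfl, map_add]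

/-- For `t = ∑ aᵢ ⊗ bᵢ`, the operator `h ↦ ∑ B(bᵢ, h) aᵢ` has trace `∑ B(bᵢ, aᵢ)`. -/
lemma trace_eq_of_apply_eq_rid [FiniteDimensional ℂ A] (t : A ⊗[ℂ] A) (B : A →ₗ[ℂ] A →ₗ[ℂ] ℂ)
    (T : A →ₗ[ℂ] A) (hT : ∀ h, T h = TensorProduct.rid ℂ A ((B.flip h).lTensor A t)) :
    LinearMap.trace ℂ A T = TensorProduct.lift B.flip t := by
  rw [trace_eq_of_apply_eq_lid (TensorProduct.comm ℂ A A t) B T]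
  · exact LinearMap.congr_fun
      (show TensorProduct.lift B ∘ₗ (TensorProduct.comm ℂ A A).toLinearMap =
        TensorProduct.lift B.flip by ext; simp) t
  · intro h
    rw [hT]
    clear hT
    induction t with
    | zero => simp
    | tmul x y => simp
    | add x y hx hy => simp only [map_add, hx, hy]

namespace IsNormalizedIntegral

variable {Λ : A} (hΛ : IsNormalizedIntegral Λ)
include hΛ

lemma mul_rhit (f : DualAlg A) (h : A) : h * rhit f Λ = rhit (ltrans (antipode ℂ h) f) Λ := by
  have := congrArg (fun t => TensorProduct.lid ℂ A (f.ofConv.rTensor A t)) (hΛ.inr_mul_comul h)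
  simp only [lid_rTensor_inr_mul, lid_rTensor_inl_mul] at this
  exact this

lemma lhit_ltrans (f : DualAlg A) (h : A) :
    lhit (ltrans h f) Λ = antipode ℂ h * lhit f Λ := by
  have := congrArg (fun t => TensorProduct.rid ℂ A (f.ofConv.lTensor A t)) (hΛ.inr_mul_comul h)
  simp only [rid_lTensor_inr_mul, rid_lTensor_inl_mul] at this
  exact this

lemma rhit_rtrans (f : DualAlg A) (h : A) :
    rhit (rtrans h f) Λ = rhit f Λ * antipode ℂ h := by
  have := congrArg (fun t => TensorProduct.lid ℂ A (f.ofConv.rTensor A t)) (hΛ.comul_mul_inl h)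
  simp only [lid_rTensor_mul_inr, lid_rTensor_mul_inl] at this
  exact this

lemma lhit_mul_eq (f : DualAlg A) (h : A) :
    lhit f Λ * h = lhit (rtrans (antipode ℂ h) f) Λ := by
  have := congrArg (fun t => TensorProduct.rid ℂ A (f.ofConv.lTensor A t)) (hΛ.comul_mul_inl h)
  simp only [rid_lTensor_mul_inr, rid_lTensor_mul_inl] at this
  exact this

/-- If `f(Λ₁)Λ₂ = 0`, then `f(Λ₁h)Λ₂ = 0` for all `h`, and the trace of `h ↦ f(Λ₁S(h))Λ₂` is
`f(Λ₁S(Λ₂)) = f(1)`. -/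
lemma eq_zero_of_rhit_eq_zero {f : DualAlg A} (hf : rhit f Λ = 0) : f = 0 := by
  have := hΛ.finiteDimensional
  have key : ∀ f : DualAlg A, rhit f Λ = 0 → f 1 = 0 := by
    intro f hf
    have h0 := trace_eq_of_apply_eq_lid (comul (R := ℂ) Λ)
      ((LinearMap.mul ℂ A).compl₂ (antipode ℂ) |>.compr₂ f.ofConv) 0 fun h => by
        have := hΛ.rhit_rtrans f (antipode ℂ h)
        rw [hf, zero_mul] at this
        exact this.symm
    rw [map_zero] at h0
    have h1 : TensorProduct.lift ((LinearMap.mul ℂ A).compl₂ (antipode ℂ) |>.compr₂ f.ofConv) =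
        f.ofConv ∘ₗ mul' ℂ A ∘ₗ (antipode ℂ).lTensor A := by
      ext; simp
    rw [h1] at h0
    simpa [hΛ.counit_eq] using h0.symm
  ext x
  have := key (rtrans x f) (by rw [hΛ.rhit_rtrans, hf, zero_mul])
  simpa using this

lemma eq_zero_of_lhit_eq_zero {f : DualAlg A} (hf : lhit f Λ = 0) : f = 0 := by
  have := hΛ.finiteDimensional
  have key : ∀ f : DualAlg A, lhit f Λ = 0 → f 1 = 0 := by
    intro f hf
    have h0 := trace_eq_of_apply_eq_rid (comul (R := ℂ) Λ)
      ((LinearMap.mul ℂ A).comp (antipode ℂ) |>.compr₂ f.ofConv).flip 0 fun h => by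
        have := hΛ.lhit_ltrans f (antipode ℂ h)
        rw [hf, mul_zero] at this
        exact this.symm
    rw [map_zero] at h0
    have h1 : TensorProduct.lift
        ((LinearMap.mul ℂ A).comp (antipode ℂ) |>.compr₂ f.ofConv).flip.flip =
        f.ofConv ∘ₗ mul' ℂ A ∘ₗ (antipode ℂ).rTensor A := by
      ext; simp
    rw [h1] at h0
    simpa [hΛ.counit_eq] using h0.symm
  ext x
  have := key (ltrans x f) (by rw [hΛ.lhit_ltrans, hf, mul_zero])
  simpa using this

lemma exists_rhit_eq_one : ∃ f : DualAlg A, rhit f Λ = 1 := by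
  have := hΛ.finiteDimensional
  let T : Module.Dual ℂ A →ₗ[ℂ] A :=
    { toFun := fun f => rhit (toConv f) Λ
      map_add' := fun f g => by simp [rhit, LinearMap.rTensor_add]
      map_smul' := fun c f => by simp [rhit, LinearMap.rTensor_smul] }
  have hT : Function.Injective T := by
    rw [← LinearMap.ker_eq_bot, LinearMap.ker_eq_bot']
    exact fun f hf => toConv_eq_zero.mp (hΛ.eq_zero_of_rhit_eq_zero hf)
  obtain ⟨f, hf⟩ := (LinearMap.injective_iff_surjective_of_finrank_eq_finrank
    Subspace.dual_finrank_eq).mp hT 1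
  exact ⟨toConv f, hf⟩

lemma exists_lhit_eq_one : ∃ f : DualAlg A, lhit f Λ = 1 := by
  have := hΛ.finiteDimensional
  let T : Module.Dual ℂ A →ₗ[ℂ] A :=
    { toFun := fun f => lhit (toConv f) Λ
      map_add' := fun f g => by simp [lhit, LinearMap.lTensor_add]
      map_smul' := fun c f => by simp [lhit, LinearMap.lTensor_smul] }
  have hT : Function.Injective T := by
    rw [← LinearMap.ker_eq_bot, LinearMap.ker_eq_bot']
    exact fun f hf => toConv_eq_zero.mp (hΛ.eq_zero_of_lhit_eq_zero hf)
  obtain ⟨f, hf⟩ := (LinearMap.injective_iff_surjective_of_finrank_eq_finrank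
    Subspace.dual_finrank_eq).mp hT 1
  exact ⟨toConv f, hf⟩

lemma rhit_injective {f g : DualAlg A} (h : rhit f Λ = rhit g Λ) : f = g := by
  rw [← sub_eq_zero]
  refine hΛ.eq_zero_of_rhit_eq_zero ?_
  rw [← sub_eq_zero, ← LinearMap.sub_apply] at h
  rw [← h]
  simp [rhit, LinearMap.rTensor_sub]

lemma lhit_injective {f g : DualAlg A} (h : lhit f Λ = lhit g Λ) : f = g := by
  rw [← sub_eq_zero]
  refine hΛ.eq_zero_of_lhit_eq_zero ?_
  rw [← sub_eq_zero, ← LinearMap.sub_apply] at h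
  rw [← h]
  simp [lhit, LinearMap.lTensor_sub]

lemma antipode_injective : Function.Injective (antipode ℂ (A := A)) := by
  obtain ⟨l, hl⟩ := hΛ.exists_rhit_eq_one
  rw [← LinearMap.ker_eq_bot, LinearMap.ker_eq_bot']
  intro h hh
  have h1 := hΛ.mul_rhit l h
  rw [hl, mul_one, hh] at h1
  rw [h1, show ltrans 0 l = 0 by ext; simp [ltrans]]
  simp [rhit]

section

variable {l ρ : DualAlg A} (hl : rhit l Λ = 1) (hρ : lhit ρ Λ = 1)

include hl in
/-- Both sides, as functionals of `x`, are mapped to `S(h)` by `f ↦ f(Λ₁)Λ₂`. -/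
lemma apply_antipode_sq_mul (h x : A) : l (antipode ℂ (antipode ℂ h) * x) = l (x * h) := by
  have : ltrans (antipode ℂ (antipode ℂ h)) l = rtrans h l := hΛ.rhit_injective (by
    rw [← hΛ.mul_rhit, hΛ.rhit_rtrans, hl, mul_one, one_mul])
  exact LinearMap.congr_fun (congrArg ofConv this) x

include hρ in
/-- Both sides, as functionals of `x`, are mapped to `S(h)` by `f ↦ Λ₁f(Λ₂)`. -/
lemma apply_mul_antipode_sq (h x : A) : ρ (x * antipode ℂ (antipode ℂ h)) = ρ (h * x) := by
  have : rtrans (antipode ℂ (antipode ℂ h)) ρ = ltrans h ρ := hΛ.lhit_injective (by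
    rw [← hΛ.lhit_mul_eq, hΛ.lhit_ltrans, hρ, mul_one, one_mul])
  exact LinearMap.congr_fun (congrArg ofConv this) x

include hl in
lemma eq_zero_of_right_integral {h : A} (hh : ∀ x, l (x * h) = 0) : h = 0 := by
  refine hΛ.antipode_injective ?_
  have h1 := hΛ.rhit_rtrans l h
  rw [hl, one_mul, show rtrans h l = 0 by ext x; exact hh x] at h1
  rw [← h1, map_zero]
  simp [rhit]

include hρ in
/-- `ρ` is a left integral of the dual algebra. -/
lemma mul_left_integral (f : DualAlg A) : f * ρ = f 1 • ρ := by
  refine hΛ.lhit_injective ?_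
  rw [lhit_mul, hρ, lhit_one, ← hρ]
  simp [lhit, LinearMap.lTensor_smul]

include hl in
/-- `l` is a right integral of the dual algebra. -/
lemma right_integral_mul (f : DualAlg A) : l * f = f 1 • l := by
  refine hΛ.rhit_injective ?_
  rw [rhit_mul, hl, rhit_one, ← hl]
  simp [rhit, LinearMap.rTensor_smul]

omit hΛ in
include hl in
lemma apply_integral_of_right : l Λ = 1 := by
  have h1 : (l * 1) Λ = 1 := by
    rw [mul_apply_eq_rhit, hl, one_apply, Bialgebra.counit_one]
  rwa [mul_one] at h1

omit hΛ in
include hρ in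
lemma apply_integral_of_left : ρ Λ = 1 := by
  have h1 : (1 * ρ) Λ = 1 := by
    rw [mul_apply_eq_lhit, hρ, one_apply, Bialgebra.counit_one]
  rwa [one_mul] at h1

include hl in
/-- The right integral of the dual algebra is a left semi-invariant: left multiplication by `f`
scales it by `f(g)`, where `g = Λ₁ l(Λ₂)` is the distinguished group-like element. -/
lemma mul_right_integral (f : DualAlg A) : f * l = f (lhit l Λ) • l := by
  have h1 : ∀ k : DualAlg A, f * l * k = k 1 • (f * l) := fun k => by
    rw [mul_assoc, hΛ.right_integral_mul hl, mul_smul_comm]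
  refine hΛ.rhit_injective (dual_ext fun k => ?_)
  rw [← mul_apply_eq_rhit, ← mul_apply_eq_rhit, h1, smul_mul_assoc, hΛ.right_integral_mul hl,
    ← mul_apply_eq_lhit]
  change k 1 * (f * l) Λ = (f * l) Λ * (k 1 * l Λ)
  rw [apply_integral_of_right hl]
  ring

include hl in
lemma isGroupLikeElem_lhit : IsGroupLikeElem ℂ (lhit l Λ) := by
  have hl0 : l ≠ 0 := by
    rintro rfl
    simpa using apply_integral_of_right hl
  have key : ∀ f k : DualAlg A, (f * k) (lhit l Λ) = f (lhit l Λ) * k (lhit l Λ) := by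
    intro f k
    have h1 : (f * k) (lhit l Λ) • l = (f (lhit l Λ) * k (lhit l Λ)) • l := by
      rw [← hΛ.mul_right_integral hl, mul_assoc, hΛ.mul_right_integral hl k, mul_smul_comm,
        hΛ.mul_right_integral hl f, smul_smul, mul_comm]
    exact smul_left_injective ℂ hl0 h1
  refine ⟨?_, tensor_ext fun f => dual_ext fun k => ?_⟩
  · rw [← one_apply, ← mul_apply_eq_lhit, one_mul, apply_integral_of_right hl]
  · have h1 := key (toConv f) k
    rw [mul_apply_eq_rhit] at h1
    simpa [rhit] using h1

include hl in
/-- Radford's formula, for an algebra with a two-sided integral: `S⁴` is conjugation by the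
distinguished group-like element `g`. -/
lemma antipode_pow_four_mul (h : A) :
    antipode ℂ (antipode ℂ (antipode ℂ (antipode ℂ h))) * lhit l Λ = lhit l Λ * h := by
  set g := lhit l Λ with hg
  have hgl : IsGroupLikeElem ℂ g := hΛ.isGroupLikeElem_lhit hl
  -- The left integral is the translate of the right integral by `g`.
  have hρ : lhit (rtrans g l) Λ = 1 := by
    rw [← hgl.antipode_antipode, ← hΛ.lhit_mul_eq, ← hg, hgl.mul_antipode_cancel]
  rw [← sub_eq_zero]
  refine hΛ.eq_zero_of_right_integral hl fun x => ?_
  have h1 := hΛ.apply_mul_antipode_sq hρ (antipode ℂ (antipode ℂ h)) x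
  rw [rtrans_apply, rtrans_apply, mul_assoc (antipode ℂ (antipode ℂ h)),
    hΛ.apply_antipode_sq_mul hl] at h1
  rw [mul_sub, map_sub, ← mul_assoc, ← mul_assoc, h1, sub_self]

include hρ in
/-- The trace of `S²` is the value of the left integral at `1`. -/
lemma trace_antipode_sq : LinearMap.trace ℂ A (antipode ℂ ∘ₗ antipode ℂ) = ρ 1 := by
  have := hΛ.finiteDimensional
  let B : A →ₗ[ℂ] A →ₗ[ℂ] ℂ := (LinearMap.mul ℂ A).compl₂
    (antipode ℂ ∘ₗ antipode ℂ ∘ₗ antipode ℂ) |>.compr₂ ρ.ofConv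
  rw [trace_eq_of_apply_eq_rid (comul (R := ℂ) Λ) B]
  · have h1 : TensorProduct.lift B.flip = ρ.ofConv ∘ₗ mul' ℂ A ∘ₗ (antipode ℂ).rTensor A := by
      ext x y
      simp [B, hΛ.apply_mul_antipode_sq hρ]
    simp [h1, hΛ.counit_eq]
  · intro h
    have h1 := hΛ.lhit_mul_eq ρ (antipode ℂ (antipode ℂ h))
    rw [hρ, one_mul] at h1
    exact h1

end

/-- The square of the antipode has finite order. -/
lemma exists_antipode_sq_pow_eq_one :
    ∃ n : ℕ, 0 < n ∧ (antipode ℂ ∘ₗ antipode ℂ : Module.End ℂ A) ^ n = 1 := by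
  have := hΛ.finiteDimensional
  obtain ⟨l, hl⟩ := hΛ.exists_rhit_eq_one
  let g : GroupLike ℂ A := ⟨lhit l Λ, hΛ.isGroupLikeElem_lhit hl⟩
  have hfin : Finite (GroupLike ℂ A) := (linearIndep_groupLikeVal (R := ℂ) (A := A)).finite
  obtain ⟨N, hN, hgN⟩ := (isOfFinOrder_of_finite g).exists_pow_eq_one
  refine ⟨2 * N, by omega, ?_⟩
  -- `(S⁴)ⁿ` is conjugation by `gⁿ`.
  have hpow : ∀ (n : ℕ) (h : A),
      (((antipode ℂ ∘ₗ antipode ℂ : Module.End ℂ A) ^ 2) ^ n) h * g.val ^ n = g.val ^ n * h := by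
    intro n
    induction n with
    | zero => simp
    | succ n ih =>
      intro h
      have h1 := hΛ.antipode_pow_four_mul hl
        ((((antipode ℂ ∘ₗ antipode ℂ : Module.End ℂ A) ^ 2) ^ n) h)
      rw [pow_succ' _ n, Module.End.mul_apply, pow_succ' g.val, ← mul_assoc]
      rw [mul_assoc g.val, ← ih, ← mul_assoc]
      exact congrArg (· * g.val ^ n) h1
  have hg1 : g.val ^ N = 1 := by rw [← GroupLike.val_pow, hgN, GroupLike.val_one]
  ext h
  have := hpow N h
  rwa [hg1, mul_one, one_mul, ← pow_mul] at this

end IsNormalizedIntegral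

/-! ### Inner automorphisms of finite order of products of matrix algebras -/

section Matrices

open Matrix ComplexConjugate
open scoped ComplexOrder

/-- A matrix of finite order is unitary for a suitable inner product. -/
lemma _root_.Matrix.trace_eq_conj_trace_of_pow_eq_one {d : ℕ} {U U' : Matrix (Fin d) (Fin d) ℂ}
    (hU : U * U' = 1) {m : ℕ} (hm : 0 < m) (hUm : U ^ m = 1) :
    U'.trace = conj U.trace := by
  obtain ⟨m, rfl⟩ : ∃ k, m = k + 1 := ⟨m - 1, by omega⟩
  -- `P` is the matrix of a Hermitian inner product invariant under `U`.
  let P : Matrix (Fin d) (Fin d) ℂ := ∑ k ∈ Finset.range (m + 1), (U ^ k)ᴴ * U ^ k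
  have hP : P.PosDef := by
    simp only [P]
    rw [Finset.sum_range_succ', pow_zero, conjTranspose_one, mul_one, add_comm]
    exact Matrix.PosDef.one.add_posSemidef
      (Matrix.posSemidef_sum _ fun k _ => Matrix.posSemidef_conjTranspose_mul_self _)
  have hinv : Uᴴ * P * U = P := by
    calc Uᴴ * P * U = ∑ k ∈ Finset.range (m + 1), (U ^ (k + 1))ᴴ * U ^ (k + 1) := by
          simp only [P, Finset.mul_sum, Finset.sum_mul]
          refine Finset.sum_congr rfl fun k _ => ?_
          rw [pow_succ, conjTranspose_mul]
          simp only [mul_assoc]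
      _ = P := by
          simp only [P]
          rw [Finset.sum_range_succ, Finset.sum_range_succ', hUm, pow_zero]
  have hP1 : P⁻¹ * P = 1 := Matrix.nonsing_inv_mul _ ((Matrix.isUnit_iff_isUnit_det _).mp hP.isUnit)
  have hPU : Uᴴ * P = P * U' := by
    rw [← hinv, mul_assoc (Uᴴ * P) U U', hU, mul_one, hinv]
  calc U'.trace = (P⁻¹ * (P * U')).trace := by rw [← mul_assoc, hP1, one_mul]
    _ = (Uᴴ * (P * P⁻¹)).trace := by rw [← hPU, Matrix.trace_mul_comm, mul_assoc]
    _ = conj U.trace := by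
      rw [mul_eq_one_comm.mp hP1, mul_one, Matrix.trace_conjTranspose]; rfl

/-- The inverse of a matrix with a scalar power is, up to scaling, unitary for a suitable inner
product, so its trace is a positive multiple of the conjugate of the trace of the matrix. -/
lemma _root_.Matrix.exists_trace_eq_mul_conj_trace {d : ℕ} {W W' : Matrix (Fin d) (Fin d) ℂ}
    (hW : W * W' = 1) {m : ℕ} (hm : 0 < m) {z : ℂ} (hz : W ^ m = z • 1) :
    ∃ r : ℝ, 0 < r ∧ W'.trace = r * conj W.trace := by
  rcases eq_or_ne z 0 with rfl | hz0
  · refine ⟨1, one_pos, ?_⟩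
    have h1 : (1 : Matrix (Fin d) (Fin d) ℂ) = 0 := by
      have h2 : W ^ m * W' ^ m = 1 := by
        rw [← Commute.mul_pow (by rw [Commute, SemiconjBy, hW, mul_eq_one_comm.mp hW]), hW, one_pow]
      rw [← h2, hz, zero_smul, zero_mul]
    rw [← mul_one W', ← mul_one W, h1]
    simp
  · obtain ⟨c, hc⟩ := IsAlgClosed.exists_pow_nat_eq z⁻¹ hm
    have hc0 : c ≠ 0 := by
      rintro rfl
      rw [zero_pow hm.ne'] at hc
      exact hz0 (inv_eq_zero.mp hc.symm)
    have h1 := Matrix.trace_eq_conj_trace_of_pow_eq_one (U := c • W) (U' := c⁻¹ • W')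
      (by rw [smul_mul_smul_comm, mul_inv_cancel₀ hc0, hW, one_smul]) hm
      (by rw [smul_pow, hc, hz, smul_smul, inv_mul_cancel₀ hz0, one_smul])
    rw [Matrix.trace_smul, Matrix.trace_smul, smul_eq_mul, smul_eq_mul, map_mul] at h1
    refine ⟨Complex.normSq c, Complex.normSq_pos.mpr hc0, ?_⟩
    rw [← Complex.mul_conj, mul_assoc, ← h1, mul_inv_cancel_left₀ hc0]

variable {n : ℕ} {d : Fin n → ℕ}

lemma trace_pi_conj (w w' : Π i, Matrix (Fin (d i)) (Fin (d i)) ℂ)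
    (T : Module.End ℂ (Π i, Matrix (Fin (d i)) (Fin (d i)) ℂ)) (hT : ∀ x, T x = w * x * w') :
    LinearMap.trace ℂ _ T = ∑ i, (w i).trace * (w' i).trace := by
  classical
  let b := Pi.basis fun i => Matrix.stdBasis ℂ (Fin (d i)) (Fin (d i))
  rw [LinearMap.trace_eq_matrix_trace ℂ b, Matrix.trace, Fintype.sum_sigma]
  refine Finset.sum_congr rfl fun i _ => ?_
  rw [Fintype.sum_prod_type, Matrix.trace, Matrix.trace, Finset.sum_mul_sum]
  refine Finset.sum_congr rfl fun j _ => Finset.sum_congr rfl fun k _ => ?_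
  rw [Matrix.diag_apply, LinearMap.toMatrix_apply, hT, Pi.basis_repr, Pi.basis_apply,
    Matrix.stdBasis_eq_single]
  simp only [Pi.mul_apply, Pi.single_eq_same]
  change (w i * Matrix.single j k (1 : ℂ) * w' i : Matrix (Fin (d i)) (Fin (d i)) ℂ) j k = _
  simp [Matrix.mul_apply, Matrix.single_apply, Finset.sum_ite_eq, ite_and]

lemma exists_eq_sum_trace_mul (φ : (Π i, Matrix (Fin (d i)) (Fin (d i)) ℂ) →ₗ[ℂ] ℂ) :
    ∃ w : Π i, Matrix (Fin (d i)) (Fin (d i)) ℂ, ∀ x, φ x = ∑ i, ((w * x) i).trace := by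
  classical
  let w : Π i, Matrix (Fin (d i)) (Fin (d i)) ℂ := fun i =>
    Matrix.of fun k j => φ (Pi.single i (Matrix.single j k 1))
  let ψ : (Π i, Matrix (Fin (d i)) (Fin (d i)) ℂ) →ₗ[ℂ] ℂ :=
    ∑ i, Matrix.traceLinearMap _ ℂ ℂ ∘ₗ mulLeft ℂ (w i) ∘ₗ LinearMap.proj i
  have hψ : ∀ x, ψ x = ∑ i, ((w * x) i).trace := fun x => by simp [ψ]
  refine ⟨w, fun x => ?_⟩
  rw [← hψ]
  congr 1
  refine LinearMap.pi_ext' fun i => Matrix.ext_linearMap _ fun j k => LinearMap.ext_ring ?_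
  change φ (Pi.single i (Matrix.single j k 1)) = ψ (Pi.single i (Matrix.single j k 1))
  rw [hψ, Finset.sum_eq_single i]
  · rw [Pi.mul_apply, Pi.single_eq_same, Matrix.trace_mul_single]
    simp [w]
  · intro i' _ hi
    rw [Pi.mul_apply, Pi.single_eq_of_ne hi, mul_zero, Matrix.trace_zero]
  · simp

lemma eq_of_sum_trace_mul_eq {y z : Π i, Matrix (Fin (d i)) (Fin (d i)) ℂ}
    (h : ∀ x : Π i, Matrix (Fin (d i)) (Fin (d i)) ℂ,
      ∑ i, ((x * y) i).trace = ∑ i, ((x * z) i).trace) : y = z := by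
  classical
  funext i
  refine Matrix.ext_iff_trace_mul_left.mpr fun x => ?_
  have h1 := h (Pi.single i x)
  rw [Finset.sum_eq_single i, Finset.sum_eq_single i] at h1
  · simpa using h1
  all_goals simp +contextual [Pi.single_eq_of_ne]

/-- On a product of matrix algebras, conjugation by `w` has trace `∑ tr(wᵢ) tr(wᵢ⁻¹)`. If a power of
`w` is central, this is a positive combination of the `|tr(wᵢ)|²`, so it only vanishes if all
`tr(wᵢ)` do. This is excluded by `hwp`, as the components of the central element `p` are scalars. -/
lemma trace_conj_ne_zero {w w' : Π i, Matrix (Fin (d i)) (Fin (d i)) ℂ} (hw : w * w' = 1)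
    {m : ℕ} (hm : 0 < m) (hc : ∀ x, w ^ m * x = x * w ^ m)
    {p : Π i, Matrix (Fin (d i)) (Fin (d i)) ℂ} (hp : ∀ x, p * x = x * p)
    (hwp : ∑ i, ((w * p) i).trace ≠ 0)
    {T : Module.End ℂ (Π i, Matrix (Fin (d i)) (Fin (d i)) ℂ)} (hT : ∀ x, T x = w * x * w') :
    LinearMap.trace ℂ _ T ≠ 0 := by
  classical
  have hscalar : ∀ q : Π i, Matrix (Fin (d i)) (Fin (d i)) ℂ, (∀ x, q * x = x * q) →
      ∀ i, ∃ c : ℂ, q i = c • 1 := by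
    intro q hq i
    obtain ⟨c, hc⟩ := (Matrix.mem_range_scalar_iff_commute_single' (M := q i)).mpr fun j k => by
      have := congrFun (hq (Pi.single i (Matrix.single j k 1))) i
      rw [Commute, SemiconjBy]
      simpa using this.symm
    exact ⟨c, by rw [← hc, Matrix.smul_one_eq_diagonal]; rfl⟩
  have hr : ∀ i, ∃ r : ℝ, 0 < r ∧ (w' i).trace = r * conj (w i).trace := fun i => by
    obtain ⟨z, hz⟩ := hscalar _ hc i
    exact Matrix.exists_trace_eq_mul_conj_trace (congrFun hw i) hm hz
  choose r hr0 hr using hr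
  intro h0
  rw [trace_pi_conj w w' T hT] at h0
  have h1 : ∑ i, r i * Complex.normSq (w i).trace = 0 := by
    have h2 : ((∑ i, r i * Complex.normSq (w i).trace : ℝ) : ℂ) = 0 := by
      rw [← h0]
      push_cast
      refine Finset.sum_congr rfl fun i _ => ?_
      rw [hr, ← Complex.mul_conj]
      ring
    exact_mod_cast h2
  rw [Finset.sum_eq_zero_iff_of_nonneg
    fun i _ => mul_nonneg (hr0 i).le (Complex.normSq_nonneg _)] at h1
  refine hwp (Finset.sum_eq_zero fun i hi => ?_)
  obtain ⟨c, hc⟩ := hscalar p hp i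
  have h3 : (w i).trace = 0 :=
    Complex.normSq_eq_zero.mp ((mul_eq_zero.mp (h1 i hi)).resolve_left (hr0 i).ne')
  rw [Pi.mul_apply, hc, mul_smul_comm, mul_one, Matrix.trace_smul, h3, smul_zero]

end Matrices

/-! ### The dual of a semisimple Hopf algebra -/

/-- The value at `1` of the left integral `ρ` of the dual is the trace of `S²`. By semisimplicity,
`ρ` is of the form `∑ tr(wᵢ ·)` on a product of matrix algebras, so that `ρ(xS²(h)) = ρ(hx)` makes
`S²` the conjugation by `w`. -/
lemma IsNormalizedIntegral.left_integral_one_ne_zero [IsSemisimpleRing A] {Λ : A}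
    (hΛ : IsNormalizedIntegral Λ) {ρ : DualAlg A} (hρ : lhit ρ Λ = 1) : ρ 1 ≠ 0 := by
  have := hΛ.finiteDimensional
  obtain ⟨n, d, -, ⟨e⟩⟩ := IsSemisimpleRing.exists_algEquiv_pi_matrix_of_isAlgClosed ℂ A
  obtain ⟨w, hw⟩ := exists_eq_sum_trace_mul (ρ.ofConv ∘ₗ e.symm.toLinearMap)
  have hρw : ∀ a, ρ a = ∑ i, ((w * e a) i).trace := fun a => by
    rw [← hw]
    simp
  have hcycl : ∀ x y : Π i, Matrix (Fin (d i)) (Fin (d i)) ℂ,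
      ∑ i, ((x * y) i).trace = ∑ i, ((y * x) i).trace := fun x y =>
    Finset.sum_congr rfl fun i _ => Matrix.trace_mul_comm _ _
  -- `w` is invertible because `ρ` is nondegenerate.
  obtain ⟨w', hw'⟩ : ∃ w', w * w' = 1 := by
    have hinj : Function.Injective (mulLeft ℂ w) := by
      rw [← LinearMap.ker_eq_bot, LinearMap.ker_eq_bot']
      intro x hx
      have h1 : antipode ℂ (e.symm x) = 0 := by
        have h2 := hΛ.lhit_ltrans ρ (e.symm x)
        have h3 : ltrans (e.symm x) ρ = 0 := by
          ext a
          change ρ (e.symm x * a) = 0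
          rw [hρw, map_mul, e.apply_symm_apply, ← mul_assoc, show w * x = 0 from hx]
          simp
        rw [h3, hρ, mul_one] at h2
        rw [← h2]
        simp [lhit]
      have h4 := hΛ.antipode_injective (h1.trans (map_zero _).symm)
      rw [← e.apply_symm_apply x, h4, map_zero]
    obtain ⟨w', h⟩ := LinearMap.injective_iff_surjective.mp hinj 1
    exact ⟨w', h⟩
  -- The square of the antipode is conjugation by `w`.
  have hS : ∀ a, e (antipode ℂ (antipode ℂ a)) * w = w * e a := fun a =>
    eq_of_sum_trace_mul_eq fun x => by
      have h1 := hΛ.apply_mul_antipode_sq hρ a (e.symm x)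
      rw [hρw, hρw, map_mul, map_mul, e.apply_symm_apply] at h1
      rw [← mul_assoc, hcycl _ w, h1, ← mul_assoc, hcycl]
  obtain ⟨m, hm, hSm⟩ := hΛ.exists_antipode_sq_pow_eq_one
  rw [← hΛ.trace_antipode_sq hρ, ← LinearMap.trace_conj' _ e.toLinearEquiv]
  refine trace_conj_ne_zero hw' hm (p := e Λ) ?_ ?_ ?_ ?_
  · have hpow : ∀ (k : ℕ) (a : A),
        e (((antipode ℂ ∘ₗ antipode ℂ : Module.End ℂ A) ^ k) a) * w ^ k = w ^ k * e a := by
      intro k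
      induction k with
      | zero => simp
      | succ k ih =>
        intro a
        rw [pow_succ' _ k, Module.End.mul_apply, pow_succ' w, ← mul_assoc, mul_assoc w, ← ih,
          ← mul_assoc]
        exact congrArg (· * w ^ k) (hS _)
    intro x
    have := hpow m (e.symm x)
    rw [hSm, Module.End.one_apply, e.apply_symm_apply] at this
    exact this.symm
  · intro x
    rw [← e.apply_symm_apply x, ← map_mul, ← map_mul, hΛ.left, hΛ.right]
  · rw [← hρw, apply_integral_of_left hρ]
    exact one_ne_zero
  · intro x
    rw [LinearEquiv.conj_apply]
    change e (antipode ℂ (antipode ℂ (e.symm x))) = _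
    rw [← mul_one (e _), ← hw', ← mul_assoc, hS, e.apply_symm_apply]

/-- A semisimple complex Hopf algebra has a left integral in its dual with value `1` at `1`. -/
lemma exists_dual_integral [IsSemisimpleRing A] :
    ∃ ρ : DualAlg A, ρ 1 = 1 ∧ ∀ f : DualAlg A, f * ρ = f 1 • ρ := by
  obtain ⟨Λ, hΛ⟩ := exists_isNormalizedIntegral (A := A)
  obtain ⟨ρ, hρ⟩ := hΛ.exists_lhit_eq_one
  have h0 := hΛ.left_integral_one_ne_zero hρ
  refine ⟨(ρ 1)⁻¹ • ρ, inv_mul_cancel₀ h0, fun f => ?_⟩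
  rw [mul_smul_comm, hΛ.mul_left_integral hρ, smul_comm]

lemma lhit_eq_of_left_integral {ρ : DualAlg A} (hρ : ∀ f : DualAlg A, f * ρ = f 1 • ρ) (a : A) :
    lhit ρ a = ρ a • (1 : A) :=
  dual_ext fun f => by
    rw [← mul_apply_eq_lhit, hρ, map_smul, smul_eq_mul, mul_comm]
    rfl

/-- `ρ(hS(b₁)) b₂ = h₁ ρ(h₂S(b))` for a left integral `ρ` of the dual algebra. -/
lemma rhit_left_integral_antipode {ρ : DualAlg A} (hρ : ∀ f : DualAlg A, f * ρ = f 1 • ρ)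
    (h b : A) :
    rhit (toConv (ρ.ofConv ∘ₗ mulLeft ℂ h ∘ₗ antipode ℂ)) b =
      TensorProduct.rid ℂ A (ρ.ofConv.lTensor A (comul h * inr A (antipode ℂ b))) := by
  have h1 : toConv (inr A ∘ₗ antipode ℂ) =
      toConv (comul ∘ₗ antipode ℂ : A →ₗ[ℂ] A ⊗[ℂ] A) * toConv (inl A) := by
    rw [comul_comp_antipode, mul_assoc, antipode_conv_algHom, mul_one]
  have h2 := mulLeft_comp_conv (comul (R := ℂ) h)
    (toConv (comul ∘ₗ antipode ℂ : A →ₗ[ℂ] A ⊗[ℂ] A)) (toConv (inl A))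
  rw [← h1] at h2
  have h3 : comul (R := ℂ) h * inr A (antipode ℂ b) = _ := LinearMap.congr_fun h2 b
  rw [h3]
  change _ = TensorProduct.rid ℂ A (ρ.ofConv.lTensor A ((toConv _ * toConv _ :
    WithConv (A →ₗ[ℂ] A ⊗[ℂ] A)) b))
  rw [(ℛ ℂ b).convMul_apply]
  simp only [map_sum]
  have h4 : rhit (toConv (ρ.ofConv ∘ₗ mulLeft ℂ h ∘ₗ antipode ℂ)) b =
      ∑ i ∈ (ℛ ℂ b).index, ρ (h * antipode ℂ ((ℛ ℂ b).left i)) • (ℛ ℂ b).right i := by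
    change TensorProduct.lid ℂ A (LinearMap.rTensor A _ (comul b)) = _
    conv_lhs => rw [← (ℛ ℂ b).eq]
    simp
  rw [h4]
  refine Finset.sum_congr rfl fun i _ => ?_
  rw [rid_lTensor_mul_inl]
  change _ = TensorProduct.rid ℂ A (ρ.ofConv.lTensor A
    (comul (R := ℂ) h * comul (R := ℂ) (antipode ℂ ((ℛ ℂ b).left i)))) * _
  rw [← Bialgebra.comul_mul]
  change _ = lhit ρ _ * _
  rw [lhit_eq_of_left_integral hρ, smul_mul_assoc, one_mul]

/-- Let `R` be the dual of a vector space `V`. If `T r` is the transpose of left multiplication by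
`r` and `E : V → R` satisfies `E (T r v) = E v * r`, then the tensor of `R ⊗ R` corresponding to `E`
is a separability idempotent as soon as its product is `1`. -/
lemma isSemisimpleRing_of_dual {R : Type u} [Ring R] [Algebra ℂ R] {V : Type v} [AddCommGroup V]
    [Module ℂ V] [FiniteDimensional ℂ V] (φ : R ≃ₗ[ℂ] Module.Dual ℂ V) (T : R → V →ₗ[ℂ] V)
    (hT : ∀ r x v, φ (r * x) v = φ x (T r v)) (E : V →ₗ[ℂ] R)
    (hE : ∀ r v, E (T r v) = E v * r)
    (h1 : ∀ b : Module.Basis (Fin (Module.finrank ℂ V)) ℂ V,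
      ∑ i, φ.symm (b.coord i) * E (b i) = 1) : IsSemisimpleRing R := by
  let b := Module.finBasis ℂ V
  refine isSemisimpleRing_of_separable (∑ i, φ.symm (b.coord i) ⊗ₜ[ℂ] E (b i)) (fun r => ?_) ?_
  · let Θ : R ⊗[ℂ] R ≃ₗ[ℂ] (V →ₗ[ℂ] R) :=
      (TensorProduct.congr φ (LinearEquiv.refl ℂ R)).trans (dualTensorHomEquiv ℂ V R)
    have hΘ : ∀ x y v, Θ (x ⊗ₜ y) v = φ x v • y := fun x y v => by simp [Θ]
    have hsum : ∀ v, ∑ i, b.coord i v • E (b i) = E v := fun v => by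
      conv_rhs => rw [← b.sum_repr v, map_sum]
      simp
    refine Θ.injective (LinearMap.ext fun v => ?_)
    simp only [Finset.mul_sum, Finset.sum_mul, Algebra.TensorProduct.tmul_mul_tmul, one_mul,
      mul_one, map_sum, LinearMap.sum_apply, hΘ, hT, LinearEquiv.apply_symm_apply]
    simp only [← smul_mul_assoc]
    rw [← Finset.sum_mul, hsum, hsum, hE]
  · rw [map_sum]
    exact h1 b

/-- The dual of a semisimple complex Hopf algebra is semisimple: a normalized left integral `ρ` of
`A^*` yields the separability idempotent of `A^*` corresponding to the bilinear form
`(a, b) ↦ ρ(aS(b))` on `A`. -/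
theorem isSemisimpleRing_dualAlg [IsSemisimpleRing A] : IsSemisimpleRing (DualAlg A) := by
  obtain ⟨Λ, hΛ⟩ := exists_isNormalizedIntegral (A := A)
  have := hΛ.finiteDimensional
  obtain ⟨ρ, hρ1, hρ⟩ := exists_dual_integral (A := A)
  let E : A →ₗ[ℂ] DualAlg A :=
    { toFun := fun h => toConv (ρ.ofConv ∘ₗ mulLeft ℂ h ∘ₗ antipode ℂ)
      map_add' := fun x y => by ext; simp [add_mul]
      map_smul' := fun c x => by ext; simp }
  have hE : ∀ h b, E h b = ρ (h * antipode ℂ b) := fun _ _ => rfl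
  refine isSemisimpleRing_of_dual (WithConv.linearEquiv ℂ (A →ₗ[ℂ] ℂ)) rhit
    (fun r x a => mul_apply_eq_rhit r x a) E (fun r h => ?_) fun b => ?_
  · ext a
    change E (rhit r h) a = (E h * r) a
    rw [mul_apply_eq_rhit, show E h = toConv _ from rfl, rhit_left_integral_antipode hρ, hE]
    have h3 : ∀ t : A ⊗[ℂ] A, r (TensorProduct.rid ℂ A (ρ.ofConv.lTensor A t)) =
        ρ (TensorProduct.lid ℂ A (r.ofConv.rTensor A t)) := by
      intro t
      induction t with
      | zero => simp
      | tmul x y => simp [mul_comm]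
      | add x y hx hy => simp only [map_add, hx, hy]
    rw [h3, lid_rTensor_mul_inr]
    rfl
  · have hsum : ∀ x y, ∑ i, b.coord i x * E (b i) y = E x y := fun x y => by
      conv_rhs => rw [← b.sum_repr x, map_sum, ofConv_sum, LinearMap.sum_apply]
      simp
    ext a
    simp only [ofConv_sum, LinearMap.sum_apply, symm_linearEquiv_apply]
    simp_rw [(ℛ ℂ a).convMul_apply]
    rw [Finset.sum_comm]
    change ∑ j ∈ (ℛ ℂ a).index, ∑ i, b.coord i ((ℛ ℂ a).left j) * E (b i) ((ℛ ℂ a).right j) = _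
    simp only [hsum]
    simp only [hE]
    rw [← map_sum, sum_mul_antipode_eq_smul, map_smul, hρ1, smul_eq_mul, mul_one]
    rfl

/-! ### Subcoalgebras and the dual algebra -/

/-- A subspace stable under both actions of the dual algebra is a subcoalgebra. -/
lemma comul_mem_range_mapIncl {W : Submodule ℂ A} {x : A} (hl : ∀ f, lhit f x ∈ W)
    (hr : ∀ f, rhit f x ∈ W) : comul x ∈ LinearMap.range (TensorProduct.mapIncl W W) := by
  obtain ⟨p, hp⟩ := W.subtype.exists_leftInverse_of_injective (Submodule.ker_subtype _)
  have hp' : ∀ y ∈ W, (W.subtype ∘ₗ p) y = y := fun y hy =>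
    congrArg Subtype.val (LinearMap.congr_fun hp ⟨y, hy⟩)
  have h1 : (W.subtype ∘ₗ p).lTensor A (comul x) = comul x := by
    refine tensor_ext fun f => ?_
    have : ∀ t : A ⊗[ℂ] A, TensorProduct.lid ℂ A (f.rTensor A ((W.subtype ∘ₗ p).lTensor A t)) =
        (W.subtype ∘ₗ p) (TensorProduct.lid ℂ A (f.rTensor A t)) := by
      intro t
      induction t with
      | zero => simp
      | tmul x y => simp
      | add x y hx hy => simp only [map_add, hx, hy]
    rw [this]
    exact hp' _ (hr (toConv f))
  have h2 : (W.subtype ∘ₗ p).rTensor A (comul x) = comul x := by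
    refine tensor_ext fun f => dual_ext fun k => ?_
    rw [← LinearMap.rTensor_comp_apply]
    change k (rhit (toConv (f ∘ₗ W.subtype ∘ₗ p)) x) = k (rhit (toConv f) x)
    rw [← mul_apply_eq_rhit, ← mul_apply_eq_rhit, mul_apply_eq_lhit, mul_apply_eq_lhit]
    exact congrArg f (hp' _ (hl k))
  refine ⟨TensorProduct.map p p (comul x), ?_⟩
  rw [TensorProduct.mapIncl, ← LinearMap.comp_apply, ← TensorProduct.map_comp,
    ← LinearMap.lTensor_comp_rTensor, LinearMap.comp_apply, h2, h1]

lemma IsHopfSubalgebra.rhit_mem {K : Subalgebra ℂ A} (hK : IsHopfSubalgebra K) {x : A}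
    (hx : x ∈ K) (f : DualAlg A) : rhit f x ∈ K := by
  obtain ⟨s, hs⟩ := hK.comul_mem x hx
  change TensorProduct.lid ℂ A (f.ofConv.rTensor A (comul x)) ∈ K
  rw [← hs]
  clear hs
  induction s with
  | zero => simp
  | tmul a b => simpa using K.smul_mem b.2 _
  | add a b ha hb => simp only [map_add]; exact K.add_mem ha hb

/-- An element `e` outside an ideal `N` of a semisimple algebra acts nontrivially on some simple
submodule of `R ⧸ N`. -/
lemma exists_simple_of_notMem {R : Type u} [Ring R] [Algebra ℂ R] [FiniteDimensional ℂ R]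
    [IsSemisimpleRing R] {N : Ideal R} {e : R} (he : e ∉ N) :
    ∃ (V : Type u) (_ : AddCommGroup V) (_ : Module ℂ V) (_ : Module R V)
      (_ : IsScalarTower ℂ R V), FiniteDimensional ℂ V ∧ IsSimpleModule R V ∧
      (∀ f : R, (∀ r, f * r ∈ N) → ∀ v : V, f • v = 0) ∧ ∃ v : V, e • v ≠ 0 := by
  by_contra! hcon
  have hsimple : ∀ V : Submodule R (R ⧸ N), IsSimpleModule R V → ∀ v ∈ V, e • v = 0 := by
    intro V hV v hv
    have hfin : FiniteDimensional ℂ V :=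
      inferInstanceAs (FiniteDimensional ℂ (V.restrictScalars ℂ))
    refine congrArg Subtype.val (hcon V _ _ _ inferInstance hfin hV ?_ ⟨v, hv⟩)
    rintro f hf ⟨v, hv⟩
    obtain ⟨r, rfl⟩ := Submodule.Quotient.mk_surjective _ v
    refine Subtype.ext ?_
    change f • (Submodule.Quotient.mk r : R ⧸ N) = 0
    rw [← Submodule.Quotient.mk_smul, Submodule.Quotient.mk_eq_zero]
    exact hf r
  have htop : ∀ m : R ⧸ N, e • m = 0 := by
    intro m
    have hm : m ∈ ⨆ V : {V : Submodule R (R ⧸ N) | IsSimpleModule R V},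
        (V : Submodule R (R ⧸ N)) := by
      rw [← sSup_eq_iSup', IsSemisimpleModule.sSup_simples_eq_top]
      trivial
    induction hm using Submodule.iSup_induction' with
    | mem V v hv => exact hsimple V V.2 v hv
    | zero => exact smul_zero _
    | add x y _ _ hx hy => rw [smul_add, hx, hy, add_zero]
  have := htop (Submodule.Quotient.mk 1)
  rw [← Submodule.Quotient.mk_smul, Submodule.Quotient.mk_eq_zero, smul_eq_mul, mul_one] at this
  exact he this

/-- If `A^*` is semisimple, a subcoalgebra `C` is contained in every left coideal `D` that contains
the irreducible characters of `A^*` lying in `C`. -/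
lemma le_of_irrDualCharacters_mem [FiniteDimensional ℂ A] [IsSemisimpleRing (DualAlg A)]
    {C D : Submodule ℂ A}
    (hCl : ∀ x ∈ C, ∀ f, lhit f x ∈ C) (hCr : ∀ x ∈ C, ∀ f, rhit f x ∈ C)
    (hDr : ∀ x ∈ D, ∀ f, rhit f x ∈ D)
    (hCD : ∀ d ∈ irrDualCharacters A, d ∈ C → d ∈ D) : C ≤ D := by
  -- `N` and `J` are the annihilators of `C` and of `C ⊓ D` in the dual algebra.
  let N : Ideal (DualAlg A) :=
    { carrier := {f | ∀ x ∈ C, f x = 0}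
      add_mem' := fun {f g} hf hg x hx => by
        change f x + g x = 0
        rw [hf x hx, hg x hx, add_zero]
      zero_mem' := fun _ _ => rfl
      smul_mem' := fun f g hg x hx => by
        change (f * g) x = 0
        rw [mul_apply_eq_rhit, hg _ (hCr x hx f)] }
  let J : Ideal (DualAlg A) :=
    { carrier := {f | ∀ x ∈ C ⊓ D, f x = 0}
      add_mem' := fun {f g} hf hg x hx => by
        change f x + g x = 0
        rw [hf x hx, hg x hx, add_zero]
      zero_mem' := fun _ _ => rfl
      smul_mem' := fun f g hg x hx => by
        change (f * g) x = 0
        rw [mul_apply_eq_rhit, hg _ ⟨hCr x hx.1 f, hDr x hx.2 f⟩] }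
  have hNC : ∀ x : A, (∀ f ∈ N, f x = 0) → x ∈ C := fun x hx => by
    by_contra hxC
    obtain ⟨f, hf, hCf⟩ := C.exists_le_ker_of_notMem hxC
    exact hf (hx (toConv f) fun y hy => hCf hy)
  obtain ⟨e, he, hJe⟩ := IsSemisimpleRing.ideal_eq_span_idempotent J
  have heJ : e ∈ J := hJe ▸ Ideal.subset_span rfl
  suffices heN : e ∈ N by
    intro x hx
    by_contra hxD
    obtain ⟨f, hf, hDf⟩ := D.exists_le_ker_of_notMem hxD
    have hfJ : toConv f ∈ J := fun y hy => hDf hy.2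
    rw [hJe] at hfJ
    exact hf ((Ideal.span_singleton_le_iff_mem N).mpr heN hfJ x hx)
  -- Otherwise `e` acts nontrivially on a simple module `V` annihilated by `N`. But the character of
  -- `V` then lies in `C`, hence in `C ⊓ D`, so that the idempotent `e` has trace zero on `V`.
  by_contra heN
  have hfin : FiniteDimensional ℂ (DualAlg A) :=
    Module.Finite.equiv (WithConv.linearEquiv ℂ (A →ₗ[ℂ] ℂ)).symm
  obtain ⟨V, _, _, _, _, hVfin, hV, hNV, v, hv⟩ := exists_simple_of_notMem heN
  let τ : DualAlg A →ₐ[ℂ] Module.End ℂ V := Algebra.lsmul ℂ ℂ V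
  let d : A := (Module.evalEquiv ℂ A).symm (LinearMap.trace ℂ V ∘ₗ τ.toLinearMap ∘ₗ
    (WithConv.linearEquiv ℂ (A →ₗ[ℂ] ℂ)).symm.toLinearMap)
  have hd : ∀ f : DualAlg A, f d = LinearMap.trace ℂ V (τ f) := fun f =>
    Module.apply_evalEquiv_symm_apply ℂ A f.ofConv _
  have hdC : d ∈ C := hNC d fun f hf => by
    have h0 : τ f = 0 := LinearMap.ext <| hNV f fun r x hx => by
      rw [mul_apply_eq_lhit, hf _ (hCl x hx r)]
    rw [hd, h0, map_zero]
  have he0 : τ e = 0 := by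
    refine LinearMap.IsIdempotentElem.eq_zero_of_trace_eq_zero (he.map τ) ?_
    rw [← hd]
    exact heJ d ⟨hdC, hCD d ⟨V, _, _, _, inferInstance, hVfin, hV, hd⟩ hdC⟩
  exact hv (LinearMap.congr_fun he0 v)

/-! ### The Hopf kernel -/

section HopfKernel

variable {B : Type v} [Ring B] [HopfAlgebra ℂ B]

/-- The algebra map `B^* → A^*` dual to a bialgebra map `A → B`. -/
def pullback (π : A →ₐc[ℂ] B) (b : DualAlg B) : DualAlg A :=
  toConv (b.ofConv ∘ₗ (π : A →ₗc[ℂ] B).toLinearMap)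

@[simp] lemma pullback_apply (π : A →ₐc[ℂ] B) (b : DualAlg B) (a : A) :
    pullback π b a = b (π a) := rfl

lemma pullback_mul (π : A →ₐc[ℂ] B) (b c : DualAlg B) :
    pullback π (b * c) = pullback π b * pullback π c :=
  WithConv.ext (convMul_comp_coalgHom_distrib b c (π : A →ₗc[ℂ] B))

/-- The transpose of the antipode on the dual algebra. -/
def dualAntipode (f : DualAlg A) : DualAlg A := toConv (f.ofConv ∘ₗ antipode ℂ)

@[simp] lemma dualAntipode_apply (f : DualAlg A) (a : A) : dualAntipode f a = f (antipode ℂ a) := rfl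

lemma mul_apply_antipode (f g : DualAlg A) (a : A) :
    (f * g) (antipode ℂ a) = (dualAntipode g * dualAntipode f) a := by
  have h1 : comul (R := ℂ) (antipode ℂ a) = ∑ i ∈ (ℛ ℂ a).index,
      antipode ℂ ((ℛ ℂ a).right i) ⊗ₜ[ℂ] antipode ℂ ((ℛ ℂ a).left i) := by
    have := LinearMap.congr_fun (congrArg ofConv (comul_comp_antipode (A := A))) a
    rw [(ℛ ℂ a).convMul_apply] at this
    simpa using this
  rw [convMul_apply, h1, (ℛ ℂ a).convMul_apply]
  simp [mul_comm]

/-- A bialgebra map commutes with the antipodes: both composites are its convolution inverse. -/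
lemma bialgHom_antipode (π : A →ₐc[ℂ] B) (a : A) : π (antipode ℂ a) = antipode ℂ (π a) := by
  have h1 := convMul_comp_coalgHom_distrib (toConv (antipode ℂ)) (toConv LinearMap.id)
    (π : A →ₗc[ℂ] B)
  rw [antipode_mul_id] at h1
  have h2 : toConv (antipode ℂ ∘ₗ (π : A →ₗc[ℂ] B).toLinearMap) =
      toConv ((π : A →ₐ[ℂ] B).toLinearMap ∘ₗ antipode ℂ) := by
    refine left_inv_eq_right_inv (a := toConv (π : A →ₐ[ℂ] B).toLinearMap) ?_
      (algHom_conv_antipode _)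
    refine WithConv.ext (h1.symm.trans ?_)
    ext x
    change algebraMap ℂ B (counit (π x)) = algebraMap ℂ B (counit x)
    rw [CoalgHomClass.counit_comp_apply]
  exact (LinearMap.congr_fun (toConv_injective h2) a).symm

/-- Membership in the Hopf kernel, tested against functionals `f ⊗ b ⊗ g` of the three factors. -/
lemma mem_hopfKernel_iff {π : A →ₐc[ℂ] B} {a : A} :
    a ∈ hopfKernel π ↔ ∀ (f g : DualAlg A) (b : DualAlg B),
      (f * pullback π b * g) a = b 1 * (f * g) a := by
  have h1 : ∀ (f g : DualAlg A) (b : DualAlg B) (t : A ⊗[ℂ] A),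
      g (TensorProduct.lid ℂ A (b.ofConv.rTensor A (TensorProduct.lid ℂ (B ⊗[ℂ] A)
        (f.ofConv.rTensor (B ⊗[ℂ] A) (Algebra.TensorProduct.map (AlgHom.id ℂ A)
          ((Algebra.TensorProduct.map (π : A →ₐ[ℂ] B) (AlgHom.id ℂ A)).comp
            (Bialgebra.comulAlgHom ℂ A)) t))))) =
      (pullback π b * g) (TensorProduct.lid ℂ A (f.ofConv.rTensor A t)) := by
    intro f g b t
    induction t with
    | zero => simp
    | tmul x y =>
      rw [mul_apply_eq_rhit]
      have : ∀ s : A ⊗[ℂ] A, TensorProduct.lid ℂ A (b.ofConv.rTensor A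
          (Algebra.TensorProduct.map (π : A →ₐ[ℂ] B) (AlgHom.id ℂ A) s)) =
          TensorProduct.lid ℂ A ((pullback π b).ofConv.rTensor A s) := by
        intro s
        induction s with
        | zero => simp
        | tmul z w => simp
        | add z w hz hw => simp only [map_add, hz, hw]
      simp [rhit, this]
    | add x y hx hy => simp only [map_add, hx, hy]
  have h2 : ∀ (f g : DualAlg A) (b : DualAlg B) (t : A ⊗[ℂ] A),
      g (TensorProduct.lid ℂ A (b.ofConv.rTensor A (TensorProduct.lid ℂ (B ⊗[ℂ] A)
        (f.ofConv.rTensor (B ⊗[ℂ] A) (Algebra.TensorProduct.map (AlgHom.id ℂ A)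
          (Algebra.TensorProduct.includeRight : A →ₐ[ℂ] B ⊗[ℂ] A) t))))) =
      b 1 * g (TensorProduct.lid ℂ A (f.ofConv.rTensor A t)) := by
    intro f g b t
    induction t with
    | zero => simp
    | tmul x y => simp; ring
    | add x y hx hy => simp only [map_add, hx, hy, mul_add]
  constructor
  · intro h f g b
    rw [mul_assoc, mul_apply_eq_rhit f, mul_apply_eq_rhit f]
    refine (h1 f g b (comul a)).symm.trans (Eq.trans ?_ (h2 f g b (comul a)))
    exact congrArg (fun t => g (TensorProduct.lid ℂ A (b.ofConv.rTensor A
      (TensorProduct.lid ℂ (B ⊗[ℂ] A) (f.ofConv.rTensor (B ⊗[ℂ] A) t))))) h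
  · intro h
    refine tensor_ext fun f => tensor_ext fun b => dual_ext fun g => ?_
    have h3 := h (toConv f) g (toConv b)
    rw [mul_assoc, mul_apply_eq_rhit (toConv f), mul_apply_eq_rhit (toConv f)] at h3
    exact (h1 (toConv f) g (toConv b) (comul a)).trans
      (h3.trans (h2 (toConv f) g (toConv b) (comul a)).symm)

lemma lhit_mem_hopfKernel {π : A →ₐc[ℂ] B} {a : A} (ha : a ∈ hopfKernel π) (k : DualAlg A) :
    lhit k a ∈ hopfKernel π := by
  rw [mem_hopfKernel_iff] at ha ⊢
  intro f g b
  rw [← mul_apply_eq_lhit, ← mul_apply_eq_lhit, mul_assoc (f * _), mul_assoc f g, ha]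

lemma rhit_mem_hopfKernel {π : A →ₐc[ℂ] B} {a : A} (ha : a ∈ hopfKernel π) (k : DualAlg A) :
    rhit k a ∈ hopfKernel π := by
  rw [mem_hopfKernel_iff] at ha ⊢
  intro f g b
  rw [← mul_apply_eq_rhit, ← mul_apply_eq_rhit, ← mul_assoc, ← mul_assoc, ha, mul_assoc]

lemma isHopfSubalgebra_hopfKernel (π : A →ₐc[ℂ] B) : IsHopfSubalgebra (hopfKernel π) where
  comul_mem x hx := comul_mem_range_mapIncl (W := Subalgebra.toSubmodule (hopfKernel π))
    (lhit_mem_hopfKernel hx) (rhit_mem_hopfKernel hx)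
  antipode_mem x hx := by
    rw [mem_hopfKernel_iff] at hx ⊢
    intro f g b
    have h1 : dualAntipode (f * pullback π b) =
        pullback π (dualAntipode b) * dualAntipode f := by
      ext a
      change (f * pullback π b) (antipode ℂ a) = _
      rw [mul_apply_antipode]
      congr 3
      ext y
      simp [bialgHom_antipode]
    rw [mul_apply_antipode, mul_apply_antipode, h1, ← mul_assoc, hx]
    simp

lemma apply_eq_of_mem_hopfKernel {π : A →ₐc[ℂ] B} {a : A} (ha : a ∈ hopfKernel π) :
    π a = counit (R := ℂ) a • (1 : B) :=
  dual_ext fun b => by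
    have := mem_hopfKernel_iff.mp ha 1 1 b
    rw [one_mul, mul_one, mul_one, one_apply] at this
    rw [map_smul, smul_eq_mul, mul_comm, ← this, pullback_apply]

/-- Let `d` be the character of an `A^*`-module `V` with `π(d) = ε(d)1`. A normalized integral of
`B^*` acts on `V` as an idempotent of trace `ε(d) = dim V`, hence as the identity, so that `B^*`
acts on `V` through evaluation at `1`. -/
lemma mem_hopfKernel_of_mem_irrDualCharacters {π : A →ₐc[ℂ] B} [IsSemisimpleRing B] {d : A}
    (hd : d ∈ irrDualCharacters A) (hπ : π d = counit (R := ℂ) d • (1 : B)) :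
    d ∈ hopfKernel π := by
  obtain ⟨V, _, _, _, _, _, -, hd⟩ := hd
  obtain ⟨ρ, hρ1, hρ⟩ := exists_dual_integral (A := B)
  let τ : DualAlg A →ₐ[ℂ] Module.End ℂ V := Algebra.lsmul ℂ ℂ V
  have hidem : IsIdempotentElem (τ (pullback π ρ)) := by
    rw [IsIdempotentElem, ← map_mul, ← pullback_mul, hρ, hρ1, one_smul]
  have hτ : τ (pullback π ρ) = 1 := by
    refine (sub_eq_zero.mp ?_).symm
    refine LinearMap.IsIdempotentElem.eq_zero_of_trace_eq_zero hidem.one_sub ?_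
    have h1 : LinearMap.trace ℂ V (τ 1) = counit (R := ℂ) d := (hd 1).symm
    rw [map_sub, ← map_one τ, h1, ← hd, pullback_apply, hπ, map_smul, hρ1, smul_eq_mul, mul_one,
      sub_self]
  have hτb : ∀ b : DualAlg B, τ (pullback π b) = b 1 • 1 := fun b => by
    rw [← mul_one (τ _), ← hτ, ← map_mul, ← pullback_mul, hρ]
    exact map_smul τ (b 1) (pullback π ρ)
  rw [mem_hopfKernel_iff]
  intro f g b
  rw [hd, hd]
  change LinearMap.trace ℂ V (τ (f * pullback π b * g)) = b 1 * LinearMap.trace ℂ V (τ (f * g))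
  rw [map_mul τ, map_mul τ, hτb, mul_smul_comm, mul_one, smul_mul_assoc, map_smul, ← map_mul τ,
    smul_eq_mul]

end HopfKernel

/-! ### The kernel of the quotient representation -/

section Quotient

variable {H : Type u} [Ring H] [HopfAlgebra ℂ H] (I : Ideal H) [I.IsTwoSided] [I.IsHopfIdeal ℂ]

lemma smul_quotient_eq_iff (h : H) :
    (∀ m : H ⧸ I, h • m = counit (R := ℂ) h • m) ↔
      Bialgebra.Quotient.mkBialgHom (R := ℂ) I h = counit (R := ℂ) h • (1 : H ⧸ I) := by
  have hsmul : ∀ m : H ⧸ I, h • m = Ideal.Quotient.mk I h * m := fun m => by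
    obtain ⟨a, rfl⟩ := Ideal.Quotient.mk_surjective m
    rfl
  rw [Bialgebra.Quotient.mkBialgHom_apply]
  refine ⟨fun hh => ?_, fun hh m => ?_⟩
  · rw [← hh 1, hsmul, mul_one]
  · rw [hsmul, hh, smul_mul_assoc, one_mul]

lemma hopfKernel_mkBialgHom_eq_repKernel [IsSemisimpleRing H] :
    hopfKernel (Bialgebra.Quotient.mkBialgHom (R := ℂ) I) = repKernel H (H ⧸ I) := by
  obtain ⟨Λ, hΛ⟩ := exists_isNormalizedIntegral (A := H)
  have := hΛ.finiteDimensional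
  have : IsSemisimpleRing (DualAlg H) := isSemisimpleRing_dualAlg
  have : IsSemisimpleRing (H ⧸ I) :=
    (Ideal.Quotient.mk I).isSemisimpleRing_of_surjective Ideal.Quotient.mk_surjective
  refine le_antisymm (le_sInf fun K hK => ?_) (sInf_le ⟨isHopfSubalgebra_hopfKernel _, ?_⟩)
  · refine le_of_irrDualCharacters_mem (C := Subalgebra.toSubmodule (hopfKernel _))
      (D := Subalgebra.toSubmodule K) (fun _ hx => lhit_mem_hopfKernel hx)
      (fun _ hx => rhit_mem_hopfKernel hx) (fun _ hx => hK.1.rhit_mem hx) fun d hd hdC => ?_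
    exact hK.2 ⟨hd, (smul_quotient_eq_iff I d).mpr (apply_eq_of_mem_hopfKernel hdC)⟩
  · exact fun d hd =>
      mem_hopfKernel_of_mem_irrDualCharacters hd.1 ((smul_quotient_eq_iff I d).mp hd.2)

end Quotient

end HopfKer

theorem proposition2p8 (H : Type u) [Ring H] [HopfAlgebra ℂ H] [IsSemisimpleRing H]
    (I : Ideal H) [I.IsTwoSided] [I.IsHopfIdeal ℂ] :
    (HopfKer.counitActing H (H ⧸ I) : Set H) =
        {h : H | Bialgebra.Quotient.mkBialgHom (R := ℂ) I h =
          Coalgebra.counit (R := ℂ) h • (1 : H ⧸ I)} ∧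
      HopfKer.hopfKernel (Bialgebra.Quotient.mkBialgHom (R := ℂ) I) =
        HopfKer.repKernel H (H ⧸ I) ∧
      ∃ (M : Type u) (_ : AddCommGroup M) (_ : Module ℂ M) (_ : Module H M)
        (_ : IsScalarTower ℂ H M), FiniteDimensional ℂ M ∧
        HopfKer.hopfKernel (Bialgebra.Quotient.mkBialgHom (R := ℂ) I) =
          HopfKer.repKernel H M := by
  obtain ⟨Λ, hΛ⟩ := HopfKer.exists_isNormalizedIntegral (A := H)
  have := hΛ.finiteDimensional
  have hfin : FiniteDimensional ℂ (H ⧸ I) := Module.Finite.of_surjective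
    (Ideal.Quotient.mkₐ ℂ I).toLinearMap (Ideal.Quotient.mkₐ_surjective ℂ I)
  exact ⟨Set.ext fun h => HopfKer.smul_quotient_eq_iff I h,
    HopfKer.hopfKernel_mkBialgHom_eq_repKernel I,
    H ⧸ I, _, _, _, inferInstance, hfin, HopfKer.hopfKernel_mkBialgHom_eq_repKernel I⟩
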